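/- Fix $n\ge 0$. For $u\in\mathcal D'(\mathbb R^n)$ (complex-valued distributions), $\chi\in C_0^\infty(\mathbb R^n)$ and $1\le p\le\infty$ put $$\widehat{u\tau_y\chi}(\xi)=\big\langle u,\,e^{-i\langle\cdot,\xi\rangle}\chi(\cdot-y)\big\rangle,\qquad U_{\chi,p}(\xi)=\begin{cases}\sup_{y\in\mathbb R^n}|\widehat{u\tau_y\chi}(\xi)| & (p=\infty),\\[2pt] \big(\int_{\mathbb R^n}|\widehat{u\tau_y\chi}(\xi)|^p\,dy\big)^{1/p} & (p<\infty).\end{cases}$$ Let $S_w^p(\mathbb R^n)$ be the set of all $u\in\mathcal D'(\mathbb R^n)$ for which there is $\chi\in C_0^\infty(\mathbb R^n)\smallsetminus 0$ such that $U_{\chi,p}\in L^1(\mathbb R^n)$. Every element of $S_w^p(\mathbb R^n)$ is (the distribution given by) a unique bounded continuous function; products and convolutions below are the pointwise product and the convolution integral of these functions. **Proposition.** Let $1\le p,q,r\le\infty$, with the convention $1/\infty=0$. (a) If $\frac1p+\frac1q=\frac1r$, then $S_w^p\cdot S_w^q\subset S_w^r$. That is, if $u\in S_w^p(\mathbb R^n)$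 and $v\in S_w^q(\mathbb R^n)$, then $u$ and $v$ are given by bounded continuous functions $f$ and $g$, and the distribution given by $fg$ belongs to $S_w^r(\mathbb R^n)$. (b) If $\frac1p+\frac1q=1+\frac1r$, then $L^q* S_w^p\subset S_w^r$. That is, if $v\in L^q(\mathbb R^n)$ and $u\in S_w^p(\mathbb R^n)$, then $u$ is given by a bounded continuous function $f$, the integral $(v*f)(x)=\int v(y)f(x-y)\,dy$ converges absolutely for every $x\in\mathbb R^n$, the function $v*f$ is locally integrable, and the distribution given by $v*f$ belongs to $S_w^r(\mathbb R^n)$. -/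

import Mathlib

open MeasureTheory
open scoped ENNReal Distributions Convolution BoundedContinuousFunction

/-- The space `ℝⁿ` with its Euclidean structure. -/
abbrev Rn (n : ℕ) : Type := EuclideanSpace ℝ (Fin n)

/-- Complex-valued test functions `C₀^∞(ℝⁿ)`. -/
abbrev TestFun (n : ℕ) : Type := 𝓓((⊤ : TopologicalSpace.Opens (Rn n)), ℂ)

/-- Complex-valued distributions `D'(ℝⁿ)`. Mathlib describes them by their values on real-valued
test functions; see `Distr.pair` for the values on complex-valued ones. -/
abbrev Distr (n : ℕ) : Type := 𝓓'((⊤ : TopologicalSpace.Opens (Rn n)), ℂ)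

/-- The bilinear pairing `⟨u, φ⟩` of a distribution with a complex-valued test function, i.e. the
`ℂ`-linear extension of `u`: `⟨u, φ⟩ = ⟨u, Re φ⟩ + i ⟨u, Im φ⟩`. -/
noncomputable def Distr.pair {n : ℕ} (u : Distr n) (φ : TestFun n) : ℂ :=
  u (TestFunction.postcompCLM Complex.reCLM φ) +
    Complex.I * u (TestFunction.postcompCLM Complex.imCLM φ)

/-- The test function `x ↦ e^{-i⟨x, ξ⟩} χ(x - y)`. -/
noncomputable def modTranslate {n : ℕ} (χ : TestFun n) (y ξ : Rn n) : TestFun n where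
  toFun x := Complex.exp (-(Complex.I * ((inner ℝ x ξ : ℝ) : ℂ))) * χ (x - y)
  contDiff' := by
    have h1 : ContDiff ℝ (((⊤ : ℕ∞) : WithTop ℕ∞)) (fun x : Rn n => χ (x - y)) :=
      χ.contDiff.comp (contDiff_id.sub contDiff_const)
    have h2 : ContDiff ℝ (((⊤ : ℕ∞) : WithTop ℕ∞)) (fun x : Rn n => ((inner ℝ x ξ : ℝ) : ℂ)) :=
      Complex.ofRealCLM.contDiff.comp (contDiff_id.inner ℝ contDiff_const)
    exact ((contDiff_const.mul h2).neg.cexp).mul h1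
  hasCompactSupport' :=
    HasCompactSupport.mul_left
      (χ.hasCompactSupport.comp_homeomorph (Homeomorph.subRight y))
  tsupport_subset' := fun _ _ => trivial

/-- `(u τ_y χ)^(ξ) = ⟨u, e^{-i⟨·, ξ⟩} χ(· - y)⟩`, the Fourier transform at `ξ` of the distribution
`u` localized near `y` by the window `χ`. -/
noncomputable def localFourier {n : ℕ} (u : Distr n) (χ : TestFun n) (y ξ : Rn n) : ℂ :=
  u.pair (modTranslate χ y ξ)

/-- `U_{χ,p}(ξ)`: the supremum over `y` of `|(u τ_y χ)^(ξ)|` if `p = ∞`, and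
`(∫ |(u τ_y χ)^(ξ)|^p dy)^{1/p}` if `p < ∞`. -/
noncomputable def windowNorm {n : ℕ} (u : Distr n) (χ : TestFun n) (p : ℝ≥0∞) (ξ : Rn n) :
    ℝ≥0∞ :=
  if p = ∞ then ⨆ y : Rn n, ‖localFourier u χ y ξ‖ₑ
  else (∫⁻ y : Rn n, ‖localFourier u χ y ξ‖ₑ ^ p.toReal) ^ (1 / p.toReal)

/-- The space `S_w^p(ℝⁿ)`: the distributions `u` for which there is a window
`χ ∈ C₀^∞(ℝⁿ)`, `χ ≠ 0`, such that the nonnegative measurable function `U_{χ,p}` is integrable.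
(`(y, ξ) ↦ (u τ_y χ)^(ξ)` is smooth, so that measurability is automatic.) -/
def Sw (n : ℕ) (p : ℝ≥0∞) : Set (Distr n) :=
  {u | ∃ χ : TestFun n, χ ≠ 0 ∧ ∫⁻ ξ : Rn n, windowNorm u χ p ξ < ∞}

/-- The distribution `u` is (the regular distribution given by) the locally integrable
function `f`. -/
def Distr.IsFun {n : ℕ} (u : Distr n) (f : Rn n → ℂ) : Prop :=
  LocallyIntegrable f volume ∧
    ∀ φ : 𝓓((⊤ : TopologicalSpace.Opens (Rn n)), ℝ), u φ = ∫ x : Rn n, (φ x : ℂ) * f x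

/-! Write S(y,η) for the local Fourier transform of u at frequency 2πη. Membership in `Sw n p` means
that η ↦ ‖S(·,η)‖_p is integrable for some nonzero window χ. Everything rests on the inversion
formula f(x) = ‖χ‖₂⁻² ∫∫ e^{2πi⟨x,η⟩} S(s,η) conj χ(x-s) ds dη. By Hölder in s, the integral
converges absolutely and defines a bounded continuous function. That u is this function is tested on
φ: averaging u(φ|χ(·-s)|²) over s gives ‖χ‖₂² u(φ) (`integral_pair_mul_translate`), and Parseval
expresses each u(φ|χ(·-s)|²) through S(s,·) (`integral_fourierInv_mul_stft`). Both steps move u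
under an integral of test functions, which is `ContDiffMapSupportedIn.exists_integral`.

Products (`mul_mem_Sw`): with the product window, the local transform of fg is the convolution in η
of those of f and g. Minkowski and Hölder in y, then Tonelli in η, bound the resulting norm by the
product of the two norms.

Convolutions (`exists_convolution_mem_Sw`): with the same window, the local transform of v * f is
dominated by |v| * |S(·,η)| for every η, so Young's inequality in y applies frequency by frequency.
Absolute convergence of v * f is a dual use of Young's inequality on the bound for |f| given by the
inversion formula. -/

section Exchange

/-! ### Exchanging distributions with integrals of test functions. -/

open ContDiffMapSupportedIn TopologicalSpace Filter Topology

/-- Bounded continuous functions with values in the `i`-linear maps, as a normed space. -/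
def BddMultilinear (E F : Type*) [NormedAddCommGroup E] [NormedSpace ℝ E] [NormedAddCommGroup F]
    [NormedSpace ℝ F] (i : ℕ) : Type _ := E →ᵇ (E [×i]→L[ℝ] F)

variable {E F : Type*} [NormedAddCommGroup E] [NormedSpace ℝ E] [NormedAddCommGroup F]
  [NormedSpace ℝ F] {K : Compacts E}

namespace BddMultilinear

noncomputable instance (i : ℕ) : NormedAddCommGroup (BddMultilinear E F i) :=
  BoundedContinuousFunction.instNormedAddCommGroup

noncomputable instance (i : ℕ) : NormedSpace ℝ (BddMultilinear E F i) :=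
  BoundedContinuousFunction.instNormedSpace

/-- The `i`-th derivative, as a continuous linear map on `𝓓_K`. -/
noncomputable def derivMap (i : ℕ) : 𝓓_{K}(E, F) →L[ℝ] BddMultilinear E F i :=
  ⟨structureMapLM ℝ ⊤ i, (structureMapCLM ℝ ⊤ i).continuous⟩

/-- Evaluation at a point. -/
noncomputable def eval (i : ℕ) (x : E) : BddMultilinear E F i →L[ℝ] (E [×i]→L[ℝ] F) :=
  LinearMap.mkContinuous
    { toFun := fun b => (show E →ᵇ (E [×i]→L[ℝ] F) from b) x
      map_add' := fun _ _ => rfl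
      map_smul' := fun _ _ => rfl } 1
    fun b => by
      rw [one_mul]
      exact BoundedContinuousFunction.norm_coe_le_norm (show E →ᵇ (E [×i]→L[ℝ] F) from b) x

theorem norm_eval_le (i : ℕ) (x : E) (b : BddMultilinear E F i) : ‖eval i x b‖ ≤ ‖b‖ :=
  BoundedContinuousFunction.norm_coe_le_norm (show E →ᵇ (E [×i]→L[ℝ] F) from b) x

instance [CompleteSpace F] (i : ℕ) : CompleteSpace (BddMultilinear E F i) :=
  BoundedContinuousFunction.instCompleteSpace

theorem norm_le {i : ℕ} {b : BddMultilinear E F i} {C : ℝ} (hC : 0 ≤ C)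
    (h : ∀ x, ‖eval i x b‖ ≤ C) : ‖b‖ ≤ C :=
  (BoundedContinuousFunction.norm_le (f := show E →ᵇ (E [×i]→L[ℝ] F) from b) hC).2 h

theorem ext_eval {i : ℕ} {a b : BddMultilinear E F i} (h : ∀ x, eval i x a = eval i x b) : a = b :=
  BoundedContinuousFunction.ext h

theorem eval_deriv (i : ℕ) (x : E) (φ : 𝓓_{K}(E, F)) :
    eval i x (derivMap i φ) = iteratedFDeriv ℝ i φ x :=
  congrFun (structureMapLM_top_apply ℝ φ) x

theorem deriv_zero_injective :
    Function.Injective (derivMap 0 : 𝓓_{K}(E, F) →L[ℝ] BddMultilinear E F 0) :=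
  structureMapLM_zero_injective ℝ

end BddMultilinear

open BddMultilinear

/-- A continuous linear functional on `𝓓_K` factors through finitely many derivatives. -/
theorem ContDiffMapSupportedIn.exists_factor_deriv (L : 𝓓_{K}(E, F) →L[ℝ] ℂ) :
    ∃ (N : ℕ) (l : ((i : Fin (N + 1)) → BddMultilinear E F i) →L[ℝ] ℂ),
      ∀ φ, L φ = l (fun i => derivMap (i : ℕ) φ) := by
  obtain ⟨s, C, -, hL⟩ := Seminorm.bound_of_continuous
    (ContDiffMapSupportedIn.withSeminorms ℝ E F ⊤ K) ((normSeminorm ℝ ℂ).comp L.toLinearMap)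
    (continuous_norm.comp L.continuous)
  -- N is the highest derivative order among the bounding seminorms; indexing by `Fin (N + 1)`
  -- includes order N itself.
  set N := s.sup id
  let J : 𝓓_{K}(E, F) →ₗ[ℝ] ((i : Fin (N + 1)) → BddMultilinear E F i) :=
    LinearMap.pi fun i => (derivMap (i : ℕ)).toLinearMap
  -- Order 0 alone separates test functions, so the functional transports to the range of `J`, where
  -- the seminorm bound makes it continuous.
  have hJ : Function.Injective J := fun f g hfg =>
    deriv_zero_injective (congrFun hfg 0)
  have hbound : ∀ φ, ‖L φ‖ ≤ C * ‖J φ‖ := by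
    intro φ
    have h1 : ‖L φ‖ ≤ C * (s.sup (ContDiffMapSupportedIn.seminorm ℝ E F ⊤ K)) φ := hL φ
    refine h1.trans (mul_le_mul_of_nonneg_left ?_ C.2)
    refine Seminorm.finset_sup_apply_le (norm_nonneg _) fun i hi => ?_
    have hi' : i ≤ N := Finset.le_sup (f := id) hi
    exact norm_le_pi_norm (J φ) ⟨i, Nat.lt_succ_of_le hi'⟩
  let e := LinearEquiv.ofInjective J hJ
  let m : LinearMap.range J →L[ℝ] ℂ :=
    (L.toLinearMap ∘ₗ e.symm.toLinearMap).mkContinuous C fun x => by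
      have h : J (e.symm x) = (x : (i : Fin (N + 1)) → BddMultilinear E F i) :=
        congrArg Subtype.val (e.apply_symm_apply x)
      calc ‖L (e.symm x)‖ ≤ C * ‖J (e.symm x)‖ := hbound _
        _ = C * ‖x‖ := by rw [h]; rfl
  -- Hahn–Banach over ℝ, applicable because ℂ is finite-dimensional.
  obtain ⟨l, hl⟩ := m.exist_extension_of_finiteDimensional_range
  refine ⟨N, l, fun φ => ?_⟩
  have h2 : m (e φ) = l (J φ) := by rw [hl]; rfl
  have h3 : m (e φ) = L φ := congrArg L (e.symm_apply_apply φ)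
  rw [← h3, h2]
  rfl

variable {T : Type*} [MeasurableSpace T] {μ : Measure T}

/-- A curve of test functions supported in `K`, all of whose derivatives are integrable,
has an integral in `𝓓_K`, which commutes with continuous linear functionals. -/
theorem ContDiffMapSupportedIn.exists_integral [CompleteSpace F] {Φ : T → 𝓓_{K}(E, F)}
    (hint : ∀ i : ℕ, Integrable (fun t => derivMap i (Φ t)) μ) :
    ∃ Ψ : 𝓓_{K}(E, F), (∀ x, Ψ x = ∫ t, Φ t x ∂μ) ∧
      ∀ L : 𝓓_{K}(E, F) →L[ℝ] ℂ, L Ψ = ∫ t, L (Φ t) ∂μ := by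
  have hint_eval : ∀ i x, Integrable (fun t => iteratedFDeriv ℝ i (Φ t) x) μ := by
    intro i x
    simpa [eval_deriv] using (eval i x).integrable_comp (hint i)
  set b : (i : ℕ) → E → (E [×i]→L[ℝ] F) := fun i x => ∫ t, iteratedFDeriv ℝ i (Φ t) x ∂μ with hb
  set ψ : E → F := fun x => ∫ t, Φ t x ∂μ with hψ
  let c (i : ℕ) : (E [×(i + 1)]→L[ℝ] F) →L[ℝ] (E →L[ℝ] (E [×i]→L[ℝ] F)) :=
    (continuousMultilinearCurryLeftEquiv ℝ
      (fun _ : Fin (i + 1) => E) F).toContinuousLinearEquiv.toContinuousLinearMap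
  have hc_norm (i : ℕ) (z : E [×(i + 1)]→L[ℝ] F) : ‖c i z‖ = ‖z‖ :=
    (continuousMultilinearCurryLeftEquiv ℝ (fun _ : Fin (i + 1) => E) F).norm_map z
  have hcurry : ∀ i t x, fderiv ℝ (iteratedFDeriv ℝ i (Φ t)) x =
      c i (iteratedFDeriv ℝ (i + 1) (Φ t) x) := by
    intro i t x
    rw [iteratedFDeriv_succ_eq_comp_left]
    exact ((continuousMultilinearCurryLeftEquiv ℝ
      (fun _ : Fin (i + 1) => E) F).apply_symm_apply _).symm
  -- Differentiation under the integral: the sup norm of the next derivative dominates uniformly in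
  -- x and is integrable by hypothesis.
  have hderiv : ∀ i x, HasFDerivAt (b i) (c i (b (i + 1) x)) x := by
    intro i x
    have key := hasFDerivAt_integral_of_dominated_of_fderiv_le (𝕜 := ℝ) (μ := μ) (x₀ := x)
      (F := fun x t => iteratedFDeriv ℝ i (Φ t) x)
      (F' := fun x t => fderiv ℝ (iteratedFDeriv ℝ i (Φ t)) x)
      (bound := fun t => ‖derivMap (i + 1) (Φ t)‖) (s := Set.univ) univ_mem
      (Eventually.of_forall fun y => (hint_eval i y).1) (hint_eval i x) ?_ ?_
      (hint (i + 1)).norm ?_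
    · have h2 : ∫ t, fderiv ℝ (iteratedFDeriv ℝ i (Φ t)) x ∂μ = c i (b (i + 1) x) := by
        simp_rw [hcurry]
        exact ContinuousLinearMap.integral_comp_comm (𝕜 := ℝ)
          (Fₗ := E →L[ℝ] (E [×i]→L[ℝ] F)) (c i) (hint_eval (i + 1) x)
      rw [h2] at key
      exact key
    · simp_rw [hcurry]
      exact (c i).continuous.comp_aestronglyMeasurable (hint_eval (i + 1) x).1
    · refine Eventually.of_forall fun t y _ => ?_
      rw [hcurry, hc_norm, ← eval_deriv]
      exact norm_eval_le _ _ _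
    · refine Eventually.of_forall fun t y _ => ?_
      exact (((Φ t).contDiff.differentiable_iteratedFDeriv (m := i)
        (by exact_mod_cast WithTop.coe_lt_top i)) y).hasFDerivAt
  have hiter : ∀ i x, iteratedFDeriv ℝ i ψ x = b i x := by
    intro i
    induction i with
    | zero =>
      intro x
      ext m
      rw [iteratedFDeriv_zero_apply, hb, ContinuousMultilinearMap.integral_apply (hint_eval 0 x)]
      simp [hψ]
    | succ i ih =>
      intro x
      rw [iteratedFDeriv_succ_eq_comp_left, funext ih, Function.comp_apply, (hderiv i x).fderiv]
      exact (continuousMultilinearCurryLeftEquiv ℝ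
        (fun _ : Fin (i + 1) => E) F).symm_apply_apply _
  have hsmooth : ContDiff ℝ (((⊤ : ℕ∞) : WithTop ℕ∞)) ψ := by
    refine contDiff_of_differentiable_iteratedFDeriv fun m _ x => ?_
    rw [funext (hiter m)]
    exact (hderiv m x).differentiableAt
  let Ψ : 𝓓_{K}(E, F) := ⟨ψ, hsmooth, fun x hx => by
    simp only [hψ, Pi.zero_apply]
    rw [integral_congr_ae (g := fun _ => 0) (Eventually.of_forall fun t => (Φ t).zero_on_compl hx)]
    simp⟩
  refine ⟨Ψ, fun x => rfl, fun L => ?_⟩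
  -- 𝓓_K is not normed, so the Bochner integral is taken after factoring through a finite product of
  -- Banach spaces, where it commutes with `l`. Its components are identified by evaluating at
  -- points.
  obtain ⟨N, l, hl⟩ := exists_factor_deriv L
  have hintJ : Integrable (fun t => (fun i : Fin (N + 1) => derivMap (i : ℕ) (Φ t))) μ :=
    Integrable.of_eval fun i => hint i
  simp_rw [hl]
  rw [l.integral_comp_comm hintJ]
  congr 1
  funext i
  rw [eval_integral (E := fun i : Fin (N + 1) => BddMultilinear E F i)
    (f := fun t i => derivMap (i : ℕ) (Φ t)) (fun i => hint i)]
  refine ext_eval fun x => ?_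
  rw [eval_deriv, ← (eval (i : ℕ) x).integral_comp_comm (hint i)]
  simp_rw [eval_deriv]
  exact hiter i x

/-- The slice is a translate of `G` precomposed with the linear inclusion of the second factor. This
converts joint regularity and joint growth bounds into statements about curves of test functions. -/
theorem iteratedFDeriv_prodMk_right {T : Type*} [NormedAddCommGroup T] [NormedSpace ℝ T]
    {G : T × E → F} (hG : ContDiff ℝ (((⊤ : ℕ∞) : WithTop ℕ∞)) G) (i : ℕ) (t : T) (x : E) :
    iteratedFDeriv ℝ i (fun x => G (t, x)) x =
      (iteratedFDeriv ℝ i G (t, x)).compContinuousLinearMap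
        (fun _ => ContinuousLinearMap.inr ℝ T E) := by
  have h1 : (fun x => G (t, x)) =
      (fun z => G ((t, 0) + z)) ∘ (ContinuousLinearMap.inr ℝ T E) := by
    funext x; simp
  rw [h1, ContinuousLinearMap.iteratedFDeriv_comp_right (ContinuousLinearMap.inr ℝ T E)
    (f := fun z => G ((t, 0) + z)) (n := ((⊤ : ℕ∞) : WithTop ℕ∞))
    (hG.comp (contDiff_const.add contDiff_id)) x (by exact_mod_cast le_top),
    iteratedFDeriv_comp_add_left']
  simp

/-- Convergence in 𝓓_K is uniform convergence of each derivative. Compactness of K upgrades joint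
continuity to this, and off K all derivatives vanish. The map `j` allows parameter spaces such as a
closed ball in phase space. -/
theorem ContDiffMapSupportedIn.continuous_of_contDiff_uncurry {T : Type*} [NormedAddCommGroup T]
    [NormedSpace ℝ T] {G : T × E → F} (hG : ContDiff ℝ (((⊤ : ℕ∞) : WithTop ℕ∞)) G)
    {X : Type*} [UniformSpace X] [WeaklyLocallyCompactSpace X] {j : X → T} (hj : Continuous j)
    {Φ : X → 𝓓_{K}(E, F)} (hΦ : ∀ s x, Φ s x = G (j s, x)) : Continuous Φ := by
  have hΦ' : ∀ s, (Φ s : E → F) = fun x => G (j s, x) := fun s => funext (hΦ s)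
  rw [continuous_iff_comp]
  intro i
  rw [continuous_iff_continuousAt]
  intro s₀
  rw [ContinuousAt, BoundedContinuousFunction.tendsto_iff_tendstoUniformly]
  have hcont : Continuous (fun p : X × K =>
      iteratedFDeriv ℝ i (Φ p.1) (p.2 : E)) := by
    simp_rw [hΦ', iteratedFDeriv_prodMk_right hG]
    refine (ContinuousMultilinearMap.compContinuousLinearMapL (𝕜 := ℝ) (F := F)
      (fun _ : Fin i => ContinuousLinearMap.inr ℝ T E)).continuous.comp ?_
    exact (hG.continuous_iteratedFDeriv (m := i) (by exact_mod_cast le_top)).comp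
      ((hj.comp continuous_fst).prodMk (continuous_subtype_val.comp continuous_snd))
  have hu := Continuous.tendstoUniformly
    (fun (s : X) (x : K) => iteratedFDeriv ℝ i (Φ s) (x : E)) hcont s₀
  rw [Metric.tendstoUniformly_iff] at hu ⊢
  intro ε hε
  refine (hu ε hε).mono fun s hs x => ?_
  simp only [Function.comp_apply, structureMapCLM_top_apply]
  by_cases hx : x ∈ K
  · exact hs ⟨x, hx⟩
  · rw [(Φ s).iteratedFDeriv_zero_on_compl hx, (Φ s₀).iteratedFDeriv_zero_on_compl hx]
    simpa using hε

end Exchange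

/-! ### Minkowski, Hölder and Young inequalities with true suprema at exponent ∞. -/

section Inequalities

variable {T Y : Type*} [MeasurableSpace T] [MeasurableSpace Y]

/-- **Minkowski's integral inequality** for a real exponent. -/
theorem lintegral_lintegral_rpow_le {μ : Measure T} {ν : Measure Y} [SigmaFinite μ] [SFinite ν]
    {P : ℝ} (hP : 1 ≤ P) {F : T → Y → ℝ≥0∞} (hF : Measurable (Function.uncurry F)) :
    (∫⁻ y, (∫⁻ t, F t y ∂μ) ^ P ∂ν) ^ (1 / P) ≤ ∫⁻ t, (∫⁻ y, F t y ^ P ∂ν) ^ (1 / P) ∂μ := by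
  have hP0 : 0 < P := by linarith
  set a : T → ℝ≥0∞ := fun t => (∫⁻ y, F t y ^ P ∂ν) ^ (1 / P) with ha
  have hFP : Measurable (Function.uncurry fun t y => F t y ^ P) := hF.pow_const P
  have ham : Measurable a := hFP.lintegral_prod_right'.pow_const _
  by_cases hI : ∫⁻ t, a t ∂μ = ∞
  · rw [hI]; exact le_top
  refine ENNReal.le_of_forall_pos_le_add fun ε hε _ => ?_
  -- A positive perturbation of total mass below ε makes the weight `b` nonzero; it is also a.e.
  -- finite, so negative powers of it are harmless.
  obtain ⟨g, hg0, hgm, hg⟩ := exists_pos_lintegral_lt_of_sigmaFinite μ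
    (ε := (ε : ℝ≥0∞)) (by exact_mod_cast hε.ne')
  set b : T → ℝ≥0∞ := fun t => a t + g t with hb
  have hbm : Measurable b := ham.add hgm.coe_nnreal_ennreal
  have hbae : ∀ᵐ t ∂μ, b t ≠ 0 ∧ b t ≠ ∞ := by
    filter_upwards [ae_lt_top ham hI] with t ht
    exact ⟨by simp [hb, (hg0 t).ne'], by simp [hb, ht.ne]⟩
  set B := ∫⁻ t, b t ∂μ with hB
  -- Hölder with exponents 1/P and 1 - 1/P for F = (b^{1-P} F^P)^{1/P} · b^{1-1/P}; this weighting
  -- replaces the usual duality argument.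
  have hpt : ∀ y, (∫⁻ t, F t y ∂μ) ^ P ≤ (∫⁻ t, b t ^ (1 - P) * F t y ^ P ∂μ) * B ^ (P - 1) := by
    intro y
    have hFy : Measurable fun t => F t y := hF.comp measurable_prodMk_right
    have h1 := ENNReal.lintegral_mul_norm_pow_le (μ := μ) (p := 1 / P) (q := 1 - 1 / P)
      (f := fun t => b t ^ (1 - P) * F t y ^ P) (g := b)
      ((hbm.pow_const _).mul (hFy.pow_const _)).aemeasurable hbm.aemeasurable
      (by positivity) (by rw [sub_nonneg, div_le_one hP0]; exact hP) (by ring)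
    have h2 : ∫⁻ t, F t y ∂μ = ∫⁻ t, (b t ^ (1 - P) * F t y ^ P) ^ (1 / P) * b t ^ (1 - 1 / P) ∂μ := by
      refine lintegral_congr_ae ?_
      filter_upwards [hbae] with t ht
      rw [ENNReal.mul_rpow_of_nonneg _ _ (by positivity), ← ENNReal.rpow_mul, ← ENNReal.rpow_mul,
        mul_one_div_cancel hP0.ne', ENNReal.rpow_one, mul_right_comm, ← ENNReal.rpow_add _ _ ht.1 ht.2,
        show (1 - P) * (1 / P) + (1 - 1 / P) = 0 by field_simp; ring, ENNReal.rpow_zero, one_mul]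
    rw [← h2] at h1
    calc (∫⁻ t, F t y ∂μ) ^ P ≤ _ := ENNReal.rpow_le_rpow h1 hP0.le
      _ = _ := by
        rw [ENNReal.mul_rpow_of_nonneg _ _ hP0.le, ← ENNReal.rpow_mul, ← ENNReal.rpow_mul,
          one_div_mul_cancel hP0.ne', ENNReal.rpow_one, show (1 - 1 / P) * P = P - 1 by field_simp]
  have hswap : ∫⁻ y, ∫⁻ t, b t ^ (1 - P) * F t y ^ P ∂μ ∂ν ≤ B := by
    rw [lintegral_lintegral_swap]
    · refine lintegral_mono_ae ?_
      filter_upwards [hbae] with t ht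
      have hFt : Measurable fun y => F t y ^ P := hFP.comp measurable_prodMk_left
      rw [lintegral_const_mul _ hFt]
      have h3 : ∫⁻ y, F t y ^ P ∂ν = a t ^ P := by
        rw [ha, ← ENNReal.rpow_mul, one_div_mul_cancel hP0.ne', ENNReal.rpow_one]
      calc b t ^ (1 - P) * ∫⁻ y, F t y ^ P ∂ν ≤ b t ^ (1 - P) * b t ^ P := by
            rw [h3]; gcongr; exact le_self_add
        _ = b t := by rw [← ENNReal.rpow_add _ _ ht.1 ht.2]; simp
    · exact (((hbm.comp measurable_snd).pow_const _).mul
        (hFP.comp measurable_swap)).aemeasurable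
  have hfin : ∫⁻ y, (∫⁻ t, F t y ∂μ) ^ P ∂ν ≤ B ^ P := by
    calc ∫⁻ y, (∫⁻ t, F t y ∂μ) ^ P ∂ν
        ≤ ∫⁻ y, (∫⁻ t, b t ^ (1 - P) * F t y ^ P ∂μ) * B ^ (P - 1) ∂ν := lintegral_mono hpt
      _ = (∫⁻ y, ∫⁻ t, b t ^ (1 - P) * F t y ^ P ∂μ ∂ν) * B ^ (P - 1) := by
          refine lintegral_mul_const _ ?_
          exact Measurable.lintegral_prod_left'
            (((hbm.comp measurable_fst).pow_const _).mul hFP)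
      _ ≤ B * B ^ (P - 1) := by gcongr
      _ = B ^ P := by
          nth_rewrite 1 [← ENNReal.rpow_one B]
          rw [← ENNReal.rpow_add_of_nonneg _ _ zero_le_one (by linarith)]
          congr 1; ring
  calc (∫⁻ y, (∫⁻ t, F t y ∂μ) ^ P ∂ν) ^ (1 / P) ≤ (B ^ P) ^ (1 / P) :=
        ENNReal.rpow_le_rpow hfin (by positivity)
    _ = B := by rw [← ENNReal.rpow_mul, mul_one_div_cancel hP0.ne', ENNReal.rpow_one]
    _ ≤ ∫⁻ t, a t ∂μ + ε := by
        rw [hB, hb, lintegral_add_left ham]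
        gcongr

/-- The `L^p` norm of a nonnegative function, with a true supremum if `p = ∞`. -/
noncomputable def supLpNorm (p : ℝ≥0∞) (h : Y → ℝ≥0∞) (ν : Measure Y) : ℝ≥0∞ :=
  if p = ∞ then ⨆ y, h y else (∫⁻ y, h y ^ p.toReal ∂ν) ^ (1 / p.toReal)

variable {ν : Measure Y} {p q r : ℝ≥0∞}

theorem supLpNorm_top (h : Y → ℝ≥0∞) : supLpNorm ∞ h ν = ⨆ y, h y := if_pos rfl

theorem supLpNorm_of_ne_top (hp : p ≠ ∞) (h : Y → ℝ≥0∞) :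
    supLpNorm p h ν = (∫⁻ y, h y ^ p.toReal ∂ν) ^ (1 / p.toReal) := if_neg hp

theorem supLpNorm_one (h : Y → ℝ≥0∞) : supLpNorm 1 h ν = ∫⁻ y, h y ∂ν := by
  simp [supLpNorm_of_ne_top]

theorem one_le_toReal_of_one_le (hp : 1 ≤ p) (hp' : p ≠ ∞) : 1 ≤ p.toReal := by
  simpa using (ENNReal.toReal_le_toReal ENNReal.one_ne_top hp').2 hp

theorem supLpNorm_mono {h k : Y → ℝ≥0∞} (hhk : ∀ y, h y ≤ k y) :
    supLpNorm p h ν ≤ supLpNorm p k ν := by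
  unfold supLpNorm
  split_ifs
  · exact iSup_mono hhk
  · gcongr with y
    exact hhk y

/-- Exponent ∞ is excluded because the true supremum sees null sets. -/
theorem supLpNorm_mono_ae (hp : p ≠ ∞) {h k : Y → ℝ≥0∞} (hhk : h ≤ᵐ[ν] k) :
    supLpNorm p h ν ≤ supLpNorm p k ν := by
  rw [supLpNorm_of_ne_top hp, supLpNorm_of_ne_top hp]
  refine ENNReal.rpow_le_rpow (lintegral_mono_ae ?_) (by positivity)
  filter_upwards [hhk] with y hy
  exact ENNReal.rpow_le_rpow hy ENNReal.toReal_nonneg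

theorem supLpNorm_const_mul {c : ℝ≥0∞} (hp : 1 ≤ p) {h : Y → ℝ≥0∞} (hh : Measurable h) :
    supLpNorm p (fun y => c * h y) ν = c * supLpNorm p h ν := by
  by_cases hp' : p = ∞
  · subst hp'
    simp [supLpNorm_top, ENNReal.mul_iSup]
  have hp1 := one_le_toReal_of_one_le hp hp'
  rw [supLpNorm_of_ne_top hp', supLpNorm_of_ne_top hp']
  simp_rw [ENNReal.mul_rpow_of_nonneg _ _ (zero_le_one.trans hp1)]
  rw [lintegral_const_mul _ (hh.pow_const _), ENNReal.mul_rpow_of_nonneg _ _ (by positivity),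
    ← ENNReal.rpow_mul, mul_one_div_cancel (by positivity), ENNReal.rpow_one]

theorem supLpNorm_comp_sub_left {G : Type*} [MeasurableSpace G] [AddCommGroup G] [MeasurableAdd G]
    [MeasurableNeg G] {ν : Measure G} [ν.IsAddLeftInvariant] [ν.IsNegInvariant]
    (h : G → ℝ≥0∞) (y : G) : supLpNorm p (fun z => h (y - z)) ν = supLpNorm p h ν := by
  unfold supLpNorm
  split_ifs
  · exact (Equiv.subLeft y).iSup_comp (g := h)
  · rw [lintegral_sub_left_eq_self (fun z => h z ^ p.toReal) y]

theorem supLpNorm_comp_add_right {G : Type*} [MeasurableSpace G] [AddCommGroup G] [MeasurableAdd G]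
    {ν : Measure G} [ν.IsAddRightInvariant]
    (h : G → ℝ≥0∞) (y : G) : supLpNorm p (fun z => h (z + y)) ν = supLpNorm p h ν := by
  unfold supLpNorm
  split_ifs
  · exact (Equiv.addRight y).iSup_comp (g := h)
  · rw [lintegral_add_right_eq_self (fun z => h z ^ p.toReal) y]

/-- **Minkowski's integral inequality.** -/
theorem supLpNorm_lintegral_le {μ : Measure T} [SigmaFinite μ] [SFinite ν] (hp : 1 ≤ p)
    {F : T → Y → ℝ≥0∞} (hF : Measurable (Function.uncurry F)) :
    supLpNorm p (fun y => ∫⁻ t, F t y ∂μ) ν ≤ ∫⁻ t, supLpNorm p (F t) ν ∂μ := by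
  by_cases hp' : p = ∞
  · subst hp'
    simp only [supLpNorm_top]
    exact iSup_le fun y => lintegral_mono fun t => le_iSup (F t) y
  · simp only [supLpNorm_of_ne_top hp']
    exact lintegral_lintegral_rpow_le (one_le_toReal_of_one_le hp hp') hF

theorem toReal_inv_add_inv (hp : 1 ≤ p) (hq : 1 ≤ q) :
    (p⁻¹ + q⁻¹).toReal = 1 / p.toReal + 1 / q.toReal := by
  have hp0 : p ≠ 0 := (zero_lt_one.trans_le hp).ne'
  have hq0 : q ≠ 0 := (zero_lt_one.trans_le hq).ne'
  rw [ENNReal.toReal_add (by simpa using hp0) (by simpa using hq0), ENNReal.toReal_inv,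
    ENNReal.toReal_inv, one_div, one_div]

/-- **Hölder's inequality.** -/
theorem supLpNorm_mul_le (hp : 1 ≤ p) (hq : 1 ≤ q) (hr : 1 ≤ r) (hpqr : p⁻¹ + q⁻¹ = r⁻¹)
    {f g : Y → ℝ≥0∞} (hf : Measurable f) (hg : Measurable g) :
    supLpNorm r (fun y => f y * g y) ν ≤ supLpNorm p f ν * supLpNorm q g ν := by
  by_cases hr' : r = ∞
  · have h0 : p⁻¹ + q⁻¹ = 0 := by rw [hpqr, hr', ENNReal.inv_top]
    obtain ⟨h1, h2⟩ := add_eq_zero.1 h0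
    rw [ENNReal.inv_eq_zero] at h1 h2
    subst h1 h2 hr'
    simp only [supLpNorm_top]
    exact iSup_le fun y => mul_le_mul' (le_iSup f y) (le_iSup g y)
  -- Infinite exponents are separated off because the finite Hölder inequality used below needs r <
  -- p strictly.
  by_cases hp' : p = ∞
  · subst hp'
    have hqr : q = r := by simpa using hpqr
    subst hqr
    rw [supLpNorm_top, ← supLpNorm_const_mul hq hg]
    exact supLpNorm_mono fun y => mul_le_mul_left (le_iSup f y) _
  by_cases hq' : q = ∞
  · subst hq'
    have hqr : p = r := by simpa using hpqr
    subst hqr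
    rw [supLpNorm_top, mul_comm, ← supLpNorm_const_mul hp hf]
    exact supLpNorm_mono fun y => by
      rw [mul_comm]; exact mul_le_mul_left (le_iSup g y) _
  have hR := one_le_toReal_of_one_le hr hr'
  have hP := one_le_toReal_of_one_le hp hp'
  have hQ := one_le_toReal_of_one_le hq hq'
  have hsum : 1 / r.toReal = 1 / p.toReal + 1 / q.toReal := by
    rw [← toReal_inv_add_inv hp hq, hpqr, ENNReal.toReal_inv, one_div]
  rw [supLpNorm_of_ne_top hr', supLpNorm_of_ne_top hp', supLpNorm_of_ne_top hq']
  refine ENNReal.lintegral_Lp_mul_le_Lq_mul_Lr (by linarith) ?_ hsum ν hf.aemeasurable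
    hg.aemeasurable
  have h3 : 1 / p.toReal < 1 / r.toReal := by
    rw [hsum]
    have : 0 < 1 / q.toReal := by positivity
    linarith
  exact (one_div_lt_one_div (by linarith) (by linarith)).1 h3

theorem lintegral_mul_le_supLpNorm (hp : 1 ≤ p) (hq : 1 ≤ q) (hpq : p⁻¹ + q⁻¹ = 1)
    {f g : Y → ℝ≥0∞} (hf : Measurable f) (hg : Measurable g) :
    ∫⁻ y, f y * g y ∂ν ≤ supLpNorm p f ν * supLpNorm q g ν := by
  rw [← supLpNorm_one]
  exact supLpNorm_mul_le hp hq le_rfl (by simpa using hpq) hf hg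

/-- **Young's convolution inequality.** -/
theorem supLpNorm_convolution_le {G : Type*} [MeasurableSpace G] [AddCommGroup G]
    [MeasurableAdd₂ G] [MeasurableNeg G] {ν : Measure G} [SFinite ν]
    [ν.IsAddLeftInvariant] [ν.IsNegInvariant] (hp : 1 ≤ p) (hq : 1 ≤ q) (hr : 1 ≤ r)
    (hpqr : p⁻¹ + q⁻¹ = 1 + r⁻¹) {k h : G → ℝ≥0∞} (hk : Measurable k) (hh : Measurable h) :
    supLpNorm r (fun y => ∫⁻ z, k z * h (y - z) ∂ν) ν ≤ supLpNorm q k ν * supLpNorm p h ν := by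
  have hsubm : ∀ y : G, Measurable fun z : G => h (y - z) := fun y => hh.comp (by fun_prop)
  by_cases hr' : r = ∞
  · subst hr'
    rw [supLpNorm_top]
    refine iSup_le fun y => ?_
    rw [← supLpNorm_comp_sub_left h y]
    exact lintegral_mul_le_supLpNorm hq hp (by rw [add_comm]; simpa using hpqr) hk (hsubm y)
  have hr0 : r⁻¹ ≠ 0 := by simpa using hr'
  -- For finite r the reciprocals of p and q sum to more than 1, so neither exponent can be
  -- infinite.
  have hrpos : (1 : ℝ≥0∞) < 1 + r⁻¹ := ENNReal.lt_add_right ENNReal.one_ne_top hr0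
  have hp' : p ≠ ∞ := by
    rintro rfl
    rw [ENNReal.inv_top, zero_add] at hpqr
    exact absurd (ENNReal.inv_le_one.2 hq) (by rw [hpqr]; exact not_le.2 hrpos)
  have hq' : q ≠ ∞ := by
    rintro rfl
    rw [ENNReal.inv_top, add_zero] at hpqr
    exact absurd (ENNReal.inv_le_one.2 hp) (by rw [hpqr]; exact not_le.2 hrpos)
  have hR := one_le_toReal_of_one_le hr hr'
  have hP := one_le_toReal_of_one_le hp hp'
  have hQ := one_le_toReal_of_one_le hq hq'
  have hsum : 1 / p.toReal + 1 / q.toReal = 1 + 1 / r.toReal := by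
    rw [← toReal_inv_add_inv hp hq, hpqr, ENNReal.toReal_add ENNReal.one_ne_top
      (by simpa using (zero_lt_one.trans_le hr).ne'), ENNReal.toReal_inv, one_div]
    simp
  rw [supLpNorm_of_ne_top hr', supLpNorm_of_ne_top hp', supLpNorm_of_ne_top hq']
  generalize p.toReal = P at *
  generalize q.toReal = Q at *
  generalize r.toReal = R at *
  have hP0 : 0 < P := by linarith
  have hQ0 : 0 < Q := by linarith
  have hR0 : 0 < R := by linarith
  have hP1 : 1 / P ≤ 1 := (div_le_one hP0).2 hP
  have hQ1 : 1 / Q ≤ 1 := (div_le_one hQ0).2 hQ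
  -- Three-factor Hölder for kh = (k^Q h^P)^{1/R} (h^P)^α (k^Q)^β. The exponent relation gives 1/R +
  -- α + β = 1, and also α = 1 - 1/Q and β = 1 - 1/P, hence nonnegativity.
  set α := 1 / P - 1 / R with hα
  set β := 1 / Q - 1 / R with hβ
  have hα0 : 0 ≤ α := by linarith
  have hβ0 : 0 ≤ β := by linarith
  set H := ∫⁻ y, h y ^ P ∂ν with hH
  set Kk := ∫⁻ y, k y ^ Q ∂ν with hKk
  have hpt : ∀ y, (∫⁻ z, k z * h (y - z) ∂ν) ^ R ≤
      (∫⁻ z, k z ^ Q * h (y - z) ^ P ∂ν) * (H ^ α * Kk ^ β) ^ R := by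
    intro y
    have h1 := ENNReal.lintegral_mul_prod_norm_pow_le (μ := ν) (Finset.univ : Finset (Fin 2))
      (g := fun z => k z ^ Q * h (y - z) ^ P)
      (f := ![fun z => h (y - z) ^ P, fun z => k z ^ Q]) (q := 1 / R) (p := ![α, β])
      (((hk.pow_const _).mul ((hsubm y).pow_const _)).aemeasurable)
      (by
        intro i _
        fin_cases i
        · exact ((hsubm y).pow_const _).aemeasurable
        · exact (hk.pow_const _).aemeasurable)
      (by
        rw [Fin.sum_univ_two]
        change 1 / R + (α + β) = 1
        rw [hα, hβ]; linarith) (by positivity)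
      (by intro i _; fin_cases i <;> simp [hα0, hβ0])
    simp only [Fin.prod_univ_two, Matrix.cons_val_zero, Matrix.cons_val_one] at h1
    have h2 : ∀ z, (k z ^ Q * h (y - z) ^ P) ^ (1 / R) *
        ((h (y - z) ^ P) ^ α * (k z ^ Q) ^ β) = k z * h (y - z) := by
      intro z
      rw [ENNReal.mul_rpow_of_nonneg _ _ (by positivity), mul_comm ((h (y - z) ^ P) ^ α),
        mul_mul_mul_comm, ← ENNReal.rpow_add_of_nonneg _ _ (by positivity) hβ0,
        ← ENNReal.rpow_add_of_nonneg _ _ (by positivity) hα0, ← ENNReal.rpow_mul,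
        ← ENNReal.rpow_mul, hα, hβ, add_sub_cancel, add_sub_cancel, mul_one_div_cancel hP0.ne',
        mul_one_div_cancel hQ0.ne', ENNReal.rpow_one, ENNReal.rpow_one]
    simp_rw [h2] at h1
    rw [lintegral_sub_left_eq_self (fun z => h z ^ P) y] at h1
    calc (∫⁻ z, k z * h (y - z) ∂ν) ^ R ≤ _ := ENNReal.rpow_le_rpow h1 hR0.le
      _ = _ := by
        rw [ENNReal.mul_rpow_of_nonneg _ _ hR0.le, ← ENNReal.rpow_mul, one_div_mul_cancel hR0.ne',
          ENNReal.rpow_one]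
  have hjoint : Measurable fun w : G × G => k w.2 ^ Q * h (w.1 - w.2) ^ P :=
    ((hk.comp measurable_snd).pow_const _).mul
      ((hh.comp (measurable_fst.sub measurable_snd)).pow_const _)
  have hint : ∫⁻ y, (∫⁻ z, k z * h (y - z) ∂ν) ^ R ∂ν ≤ (H * Kk) * (H ^ α * Kk ^ β) ^ R := by
    calc ∫⁻ y, (∫⁻ z, k z * h (y - z) ∂ν) ^ R ∂ν
        ≤ ∫⁻ y, (∫⁻ z, k z ^ Q * h (y - z) ^ P ∂ν) * (H ^ α * Kk ^ β) ^ R ∂ν := lintegral_mono hpt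
      _ = (∫⁻ y, ∫⁻ z, k z ^ Q * h (y - z) ^ P ∂ν ∂ν) * (H ^ α * Kk ^ β) ^ R :=
          lintegral_mul_const _ hjoint.lintegral_prod_right'
      _ = (H * Kk) * (H ^ α * Kk ^ β) ^ R := by
          congr 1
          rw [lintegral_lintegral_swap hjoint.aemeasurable]
          have h3 : ∀ z, ∫⁻ y, k z ^ Q * h (y - z) ^ P ∂ν = k z ^ Q * H := by
            intro z
            have hz : Measurable fun y => h (y - z) ^ P :=
              (hh.comp (measurable_id.sub_const z)).pow_const _
            rw [lintegral_const_mul _ hz,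
              lintegral_sub_right_eq_self (fun y => h y ^ P) z]
          simp_rw [h3]
          rw [lintegral_mul_const _ (hk.pow_const _), mul_comm]
  calc (∫⁻ y, (∫⁻ z, k z * h (y - z) ∂ν) ^ R ∂ν) ^ (1 / R)
      ≤ ((H * Kk) * (H ^ α * Kk ^ β) ^ R) ^ (1 / R) := ENNReal.rpow_le_rpow hint (by positivity)
    _ = Kk ^ (1 / Q) * H ^ (1 / P) := by
      rw [ENNReal.mul_rpow_of_nonneg _ _ (by positivity), ← ENNReal.rpow_mul _ R,
        mul_one_div_cancel hR0.ne', ENNReal.rpow_one, ENNReal.mul_rpow_of_nonneg _ _ (by positivity),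
        mul_mul_mul_comm, ← ENNReal.rpow_add_of_nonneg _ _ (by positivity) hα0,
        ← ENNReal.rpow_add_of_nonneg _ _ (by positivity) hβ0, mul_comm]
      rw [hα, hβ, add_sub_cancel, add_sub_cancel]

end Inequalities

/-! ### Complex pairings and regular distributions. -/

variable {n : ℕ}

/-- The complex pairing as a real-linear continuous functional. -/
noncomputable def Distr.pairCLM (u : Distr n) : TestFun n →L[ℝ] ℂ where
  toFun := u.pair
  map_add' φ ψ := by
    simp only [Distr.pair, map_add]; ring
  map_smul' c φ := by
    simp only [Distr.pair, map_smul, RingHom.id_apply, Complex.real_smul]; ring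
  cont := by
    have h := map_continuous u
    exact (h.comp (TestFunction.postcompCLM Complex.reCLM).continuous).add
      (continuous_const.mul (h.comp (TestFunction.postcompCLM Complex.imCLM).continuous))

theorem Distr.pair_smul (u : Distr n) (c : ℂ) (φ : TestFun n) : u.pair (c • φ) = c * u.pair φ := by
  have h1 : TestFunction.postcompCLM Complex.reCLM (c • φ) =
      c.re • TestFunction.postcompCLM Complex.reCLM φ -
        c.im • TestFunction.postcompCLM Complex.imCLM φ := by
    ext x; simp
  have h2 : TestFunction.postcompCLM Complex.imCLM (c • φ) =
      c.re • TestFunction.postcompCLM Complex.imCLM φ +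
        c.im • TestFunction.postcompCLM Complex.reCLM φ := by
    ext x; simp
  rw [Distr.pair, h1, h2]
  simp only [map_add, map_sub, map_smul, Complex.real_smul, Distr.pair]
  nth_rewrite 5 [← Complex.re_add_im c]
  linear_combination (-(c.im : ℂ) * u (TestFunction.postcompCLM Complex.imCLM φ)) * Complex.I_mul_I

theorem Distr.pair_ofReal (u : Distr n) (φ : 𝓓((⊤ : TopologicalSpace.Opens (Rn n)), ℝ)) :
    u.pair (TestFunction.postcompCLM Complex.ofRealCLM φ) = u φ := by
  have h1 : TestFunction.postcompCLM Complex.reCLM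
      (TestFunction.postcompCLM Complex.ofRealCLM φ) = φ := by ext x; simp
  have h2 : TestFunction.postcompCLM Complex.imCLM
      (TestFunction.postcompCLM Complex.ofRealCLM φ) = 0 := by ext x; simp
  rw [Distr.pair, h1, h2]
  simp

theorem Distr.IsFun.integrable_mul {u : Distr n} {f : Rn n → ℂ} (h : u.IsFun f) {φ : Rn n → ℂ}
    (hφ : Continuous φ) (hφc : HasCompactSupport φ) : Integrable (fun x => φ x * f x) := by
  simpa using h.1.integrable_smul_left_of_hasCompactSupport hφ hφc

theorem Distr.IsFun.pair_eq {u : Distr n} {f : Rn n → ℂ} (h : u.IsFun f) (φ : TestFun n) :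
    u.pair φ = ∫ x, φ x * f x := by
  rw [Distr.pair, h.2, h.2, ← integral_const_mul, ← integral_add]
  · refine integral_congr_ae (Filter.Eventually.of_forall fun x => ?_)
    simp only [TestFunction.postcompCLM_apply, Function.comp_apply, Complex.reCLM_apply,
      Complex.imCLM_apply]
    nth_rewrite 3 [← Complex.re_add_im (φ x)]
    ring
  · exact h.integrable_mul (Complex.continuous_ofReal.comp (Complex.continuous_re.comp φ.continuous))
      (φ.hasCompactSupport.comp_left (g := fun z : ℂ => (z.re : ℂ)) (by simp))
  · exact (h.integrable_mul (Complex.continuous_ofReal.comp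
      (Complex.continuous_im.comp φ.continuous))
      (φ.hasCompactSupport.comp_left (g := fun z : ℂ => (z.im : ℂ)) (by simp))).const_mul _

/-- The distribution given by a locally integrable function. -/
theorem Distr.exists_isFun {f : Rn n → ℂ} (hf : LocallyIntegrable f volume) :
    ∃ u : Distr n, u.IsFun f := by
  let L : 𝓓((⊤ : TopologicalSpace.Opens (Rn n)), ℝ) →L[ℝ] ℂ :=
    TestFunction.integralAgainstBilinCLM (ContinuousLinearMap.lsmul ℝ ℝ) volume f
  refine ⟨L, hf, fun φ => ?_⟩
  have h := TestFunction.integralAgainstBilinCLM_eq_integral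
    (Ω := (⊤ : TopologicalSpace.Opens (Rn n))) (n := ⊤) (μ := volume)
    (B := ContinuousLinearMap.lsmul ℝ ℝ) (φ := f) (hf.locallyIntegrableOn _) (f := φ)
  exact h.trans (by simp)

/-! ### The local Fourier transform: continuity, averaging and Parseval. -/

/-- A smooth function with compact support, as a test function. -/
def testFunOf (h : Rn n → ℂ) (hs : ContDiff ℝ (((⊤ : ℕ∞) : WithTop ℕ∞)) h)
    (hc : HasCompactSupport h) : TestFun n := ⟨h, hs, hc, fun _ _ => trivial⟩

/-- `(u τ_y χ)^(2πη)`. -/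
noncomputable def stft (u : Distr n) (χ : TestFun n) (y η : Rn n) : ℂ :=
  localFourier u χ y ((2 * Real.pi) • η)

theorem modTranslate_apply (χ : TestFun n) (y ξ x : Rn n) :
    modTranslate χ y ξ x = Complex.exp (-(Complex.I * ((inner ℝ x ξ : ℝ) : ℂ))) * χ (x - y) := rfl

/-- The factor 2π in `stft` matches the kernel e^{-i⟨x,ξ⟩} with the kernel e^{-2πi⟨x,η⟩} of
`Real.fourierChar`. -/
theorem exp_inner_eq_fourierChar (x η : Rn n) :
    Complex.exp (-(Complex.I * ((inner ℝ x ((2 * Real.pi) • η) : ℝ) : ℂ))) =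
      Real.fourierChar (-inner ℝ x η) := by
  rw [Real.fourierChar_apply, inner_smul_right]
  congr 1
  push_cast
  ring

theorem hasTemperateGrowth_cexp_ofReal :
    Function.HasTemperateGrowth (fun t : ℝ => Complex.exp (-(Complex.I * (t : ℂ)))) := by
  have hd : ∀ t : ℝ, HasDerivAt (fun t : ℝ => Complex.exp (-(Complex.I * (t : ℂ))))
      (-Complex.I * Complex.exp (-(Complex.I * (t : ℂ)))) t := by
    intro t
    have h1 : HasDerivAt (fun t : ℝ => -(Complex.I * (t : ℂ))) (-(Complex.I * 1)) t :=
      ((Complex.ofRealCLM.hasDerivAt (x := t)).const_mul Complex.I).neg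
    convert h1.cexp using 1
    ring
  -- Every derivative is a unimodular multiple of the function, so growth exponent 0 and constant 1
  -- suffice.
  refine ⟨?_, fun m => ⟨0, 1, fun t => ?_⟩⟩
  · exact ((contDiff_const.mul Complex.ofRealCLM.contDiff).neg.cexp)
  · have hm : ∀ m, iteratedDeriv m (fun t : ℝ => Complex.exp (-(Complex.I * (t : ℂ)))) =
        fun t : ℝ => (-Complex.I) ^ m * Complex.exp (-(Complex.I * (t : ℂ))) := by
      intro m
      induction m with
      | zero => simp
      | succ m ih =>
        rw [iteratedDeriv_succ, ih]
        funext t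
        rw [((hd t).const_mul _).deriv, pow_succ]
        ring
    rw [norm_iteratedFDeriv_eq_norm_iteratedDeriv, hm, norm_mul, Complex.norm_exp]
    simp

/-- Joint growth in (frequency, position) is what later bounds the x-derivatives of the modulated
window polynomially in η. -/
theorem hasTemperateGrowth_modulation :
    Function.HasTemperateGrowth (fun p : Rn n × Rn n =>
      Complex.exp (-(Complex.I * ((inner ℝ p.2 ((2 * Real.pi) • p.1) : ℝ) : ℂ)))) := by
  have h : Function.HasTemperateGrowth
      (fun p : Rn n × Rn n => inner ℝ p.2 ((2 * Real.pi) • p.1)) :=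
    (innerSL ℝ (E := Rn n)).bilinear_hasTemperateGrowth (f := fun p : Rn n × Rn n => p.2)
      (g := fun p : Rn n × Rn n => (2 * Real.pi) • p.1)
      (ContinuousLinearMap.snd ℝ (Rn n) (Rn n)).hasTemperateGrowth
      ((2 * Real.pi) • ContinuousLinearMap.fst ℝ (Rn n) (Rn n)).hasTemperateGrowth
  exact hasTemperateGrowth_cexp_ofReal.comp h

theorem contDiff_modTranslate (χ : TestFun n) :
    ContDiff ℝ (((⊤ : ℕ∞) : WithTop ℕ∞)) (fun p : (Rn n × Rn n) × Rn n =>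
      Complex.exp (-(Complex.I * ((inner ℝ p.2 ((2 * Real.pi) • p.1.2) : ℝ) : ℂ))) *
        χ (p.2 - p.1.1)) := by
  refine ContDiff.mul ?_ (χ.contDiff.comp (by fun_prop))
  exact (hasTemperateGrowth_modulation (n := n)).1.comp
    (g := fun p : Rn n × Rn n =>
      Complex.exp (-(Complex.I * ((inner ℝ p.2 ((2 * Real.pi) • p.1) : ℝ) : ℂ))))
    (f := fun p : (Rn n × Rn n) × Rn n => (p.1.2, p.2)) (by fun_prop)

open TopologicalSpace in
/-- The functional `u` on complex test functions supported in a fixed compact set. -/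
noncomputable def Distr.pairOn (u : Distr n) (K : Compacts (Rn n)) : 𝓓_{K}(Rn n, ℂ) →L[ℝ] ℂ :=
  u.pairCLM.comp (TestFunction.ofSupportedInCLM ℝ (Set.subset_univ _ :
    (K : Set (Rn n)) ⊆ (⊤ : Opens (Rn n))))

open TopologicalSpace in
theorem Distr.pairOn_apply (u : Distr n) {K : Compacts (Rn n)} (φ : 𝓓_{K}(Rn n, ℂ)) (ψ : TestFun n)
    (h : ∀ x, φ x = ψ x) : u.pairOn K φ = u.pair ψ := by
  have : TestFunction.ofSupportedIn (Set.subset_univ _ :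
    (K : Set (Rn n)) ⊆ (⊤ : Opens (Rn n))) φ = ψ := by ext x; exact h x
  rw [← this]
  rfl

open scoped Pointwise in
-- For parameters in a unit ball all the translated windows live in one compact K, where `u` is
-- continuous and the test function depends continuously on the parameters.
theorem continuous_stft (u : Distr n) (χ : TestFun n) :
    Continuous (fun z : Rn n × Rn n => stft u χ z.1 z.2) := by
  rw [continuous_iff_continuousAt]
  intro z₀
  let B : Set (Rn n × Rn n) := Metric.closedBall z₀ 1
  let K : TopologicalSpace.Compacts (Rn n) :=
    ⟨Metric.closedBall z₀.1 1 + tsupport χ, (isCompact_closedBall _ _).add χ.hasCompactSupport⟩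
  have : CompactSpace B := isCompact_iff_compactSpace.1 (isCompact_closedBall z₀ 1)
  let Φ : B → 𝓓_{K}(Rn n, ℂ) := fun z =>
    ContDiffMapSupportedIn.of_support_subset
      (f := modTranslate χ z.1.1 ((2 * Real.pi) • z.1.2)) (modTranslate χ _ _).contDiff (by
      intro x hx
      have hx' : χ (x - z.1.1) ≠ 0 := right_ne_zero_of_mul hx
      refine ⟨z.1.1, ?_, x - z.1.1, subset_tsupport _ hx', by simp⟩
      have := z.2
      rw [Metric.mem_closedBall, Prod.dist_eq] at this
      exact Metric.mem_closedBall.2 ((le_max_left _ _).trans this))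
  have hΦ : Continuous Φ := ContDiffMapSupportedIn.continuous_of_contDiff_uncurry
    (contDiff_modTranslate χ) (j := fun z : B => z.1) continuous_subtype_val (fun s x => rfl)
  have h1 : ContinuousOn (fun z : Rn n × Rn n => stft u χ z.1 z.2) B := by
    rw [continuousOn_iff_continuous_domRestrict]
    refine ((u.pairOn K).continuous.comp hΦ).congr fun z => ?_
    exact u.pairOn_apply _ _ fun x => rfl
  exact h1.continuousAt (Metric.closedBall_mem_nhds z₀ one_pos)

open BddMultilinear in
open scoped Pointwise in
/-- Averaging over translations of a window commutes with a distribution. -/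
theorem integral_pair_mul_translate (u : Distr n) (φ ρ : TestFun n) (Φ : Rn n → TestFun n)
    (hΦ : ∀ s x, Φ s x = φ x * ρ (x - s)) :
    ∫ s, u.pair (Φ s) = (∫ x, ρ x) * u.pair φ := by
  let K : TopologicalSpace.Compacts (Rn n) := ⟨tsupport φ, φ.hasCompactSupport⟩
  let ΦK : Rn n → 𝓓_{K}(Rn n, ℂ) := fun s =>
    ContDiffMapSupportedIn.of_support_subset (f := Φ s) (Φ s).contDiff (by
      intro x hx
      rw [Function.mem_support, hΦ] at hx
      exact subset_tsupport _ (left_ne_zero_of_mul hx))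
  have hG : ContDiff ℝ (((⊤ : ℕ∞) : WithTop ℕ∞))
      (fun p : Rn n × Rn n => φ p.2 * ρ (p.2 - p.1)) :=
    (φ.contDiff.comp (by fun_prop)).mul (ρ.contDiff.comp (by fun_prop))
  have hcont : Continuous ΦK := ContDiffMapSupportedIn.continuous_of_contDiff_uncurry hG
    (j := id) continuous_id hΦ
  -- Only translations in this compact set make the supports meet, so the continuous curve `ΦK` has
  -- compact support and its derivatives are integrable.
  have hzero : ∀ s, s ∉ tsupport φ - tsupport ρ → ΦK s = 0 := by
    intro s hs
    ext x
    change Φ s x = 0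
    rw [hΦ]
    by_contra hne
    exact hs ⟨x, subset_tsupport _ (left_ne_zero_of_mul hne), x - s,
      subset_tsupport _ (right_ne_zero_of_mul hne), by simp⟩
  have hcomp : IsCompact (tsupport φ - tsupport ρ) := by
    rw [sub_eq_add_neg]
    exact IsCompact.add φ.hasCompactSupport (IsCompact.neg ρ.hasCompactSupport)
  obtain ⟨Ψ, hΨ, hL⟩ := ContDiffMapSupportedIn.exists_integral (μ := volume) (Φ := ΦK) fun i =>
    ((derivMap i).continuous.comp hcont).integrable_of_hasCompactSupport
      (HasCompactSupport.intro hcomp fun s hs => by simp [hzero s hs])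
  have hΨ' : ∀ x, Ψ x = ((∫ x, ρ x) • φ : TestFun n) x := by
    intro x
    rw [hΨ]
    change ∫ s, Φ s x = (∫ x, ρ x) * φ x
    simp_rw [hΦ]
    rw [integral_const_mul, integral_sub_left_eq_self (fun z => ρ z), mul_comm]
  calc ∫ s, u.pair (Φ s) = ∫ s, u.pairOn K (ΦK s) :=
        integral_congr_ae (Filter.Eventually.of_forall fun s =>
          (u.pairOn_apply (ΦK s) (Φ s) fun x => rfl).symm)
    _ = u.pairOn K Ψ := (hL _).symm
    _ = u.pair ((∫ x, ρ x) • φ) := u.pairOn_apply _ _ hΨ'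
    _ = _ := u.pair_smul _ _

open BddMultilinear in
open scoped SchwartzMap in
/-- Parseval's formula for a localized distribution. -/
theorem integral_fourierInv_mul_stft (u : Distr n) (χ : TestFun n) (s : Rn n) (h θ : TestFun n)
    (hθ : ∀ x, θ x = χ (x - s) * h x) :
    ∫ η, FourierTransformInv.fourierInv (h : Rn n → ℂ) η * stft u χ s η = u.pair θ := by
  let hS : 𝓢(Rn n, ℂ) := h.hasCompactSupport.toSchwartzMap h.contDiff
  let g : 𝓢(Rn n, ℂ) := FourierTransformInv.fourierInv hS
  have hg : ∀ η, FourierTransformInv.fourierInv (h : Rn n → ℂ) η = g η := by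
    intro η
    change _ = (FourierTransformInv.fourierInv hS) η
    rw [SchwartzMap.fourierInv_coe]
    rfl
  have hFg : ∀ x, FourierTransform.fourier (g : Rn n → ℂ) x = h x := by
    intro x
    rw [← SchwartzMap.fourier_coe]
    change (FourierTransform.fourier (FourierTransformInv.fourierInv hS)) x = h x
    rw [FourierTransform.fourier_fourierInv_eq]
    rfl
  let K : TopologicalSpace.Compacts (Rn n) :=
    ⟨tsupport (fun x => χ (x - s)), χ.hasCompactSupport.comp_homeomorph (Homeomorph.subRight s)⟩
  have hsupp : ∀ x ∉ K, χ (x - s) = 0 := fun x hx =>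
    image_eq_zero_of_notMem_tsupport (f := fun x => χ (x - s)) hx
  let M : Rn n → Rn n → ℂ := fun η x => modTranslate χ s ((2 * Real.pi) • η) x
  let Φ : Rn n → 𝓓_{K}(Rn n, ℂ) := fun η => g η •
    ContDiffMapSupportedIn.of_support_subset (f := M η) (modTranslate χ _ _).contDiff (by
      intro x hx
      by_contra hxK
      exact hx (by
        change modTranslate χ s ((2 * Real.pi) • η) x = 0
        rw [modTranslate_apply, hsupp x hxK, mul_zero]))
  let G₀ : Rn n × Rn n → ℂ := fun p =>
    Complex.exp (-(Complex.I * ((inner ℝ p.2 ((2 * Real.pi) • p.1) : ℝ) : ℂ))) * χ (p.2 - s)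
  have hG₀ : Function.HasTemperateGrowth G₀ := by
    refine hasTemperateGrowth_modulation.mul ?_
    have h1 : Function.HasTemperateGrowth (χ : Rn n → ℂ) :=
      χ.hasCompactSupport.hasTemperateGrowth χ.contDiff
    exact h1.comp (g := χ) (f := fun p : Rn n × Rn n => p.2 - s)
      ((ContinuousLinearMap.snd ℝ (Rn n) (Rn n)).hasTemperateGrowth.sub
        (Function.HasTemperateGrowth.const s))
  have hcont : Continuous Φ := ContDiffMapSupportedIn.continuous_of_contDiff_uncurry
    (G := fun p : Rn n × Rn n => g p.1 * G₀ p)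
    (((g.smooth ⊤).comp contDiff_fst).mul hG₀.1) (j := id) continuous_id (fun s x => rfl)
  -- On K the derivatives of the modulated window grow at most polynomially in η, while `g` is
  -- Schwartz.
  have hint : ∀ i, Integrable (fun η => derivMap i (Φ η)) volume := by
    intro i
    obtain ⟨k, C, hC⟩ := hG₀.2 i
    obtain ⟨R, hR⟩ := K.isCompact.isBounded.exists_norm_le
    have hC0 : 0 ≤ C := by
      have := (norm_nonneg _).trans (hC 0)
      simpa using this
    set D := C * (1 + |R|) ^ k * 2 ^ (k - 1) with hD
    have hMi : ∀ η x, x ∈ K → ‖iteratedFDeriv ℝ i (M η) x‖ ≤ D * (1 + ‖η‖ ^ k) := by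
      intro η x hx
      have h1 : M η = fun x => G₀ (η, x) := rfl
      have hx' : ‖x‖ ≤ |R| := (hR x hx).trans (le_abs_self R)
      have h2 : ‖(η, x)‖ ≤ ‖η‖ + |R| := (norm_prod_le_iff.2
        ⟨le_add_of_nonneg_right (abs_nonneg R), hx'.trans (le_add_of_nonneg_left (norm_nonneg η))⟩)
      have h3 : ∏ _j : Fin i, ‖ContinuousLinearMap.inr ℝ (Rn n) (Rn n)‖ ≤ 1 :=
        Finset.prod_le_one (fun _ _ => norm_nonneg _)
          fun _ _ => ContinuousLinearMap.norm_inr_le_one ℝ (Rn n) (Rn n)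
      calc ‖iteratedFDeriv ℝ i (M η) x‖ ≤ ‖iteratedFDeriv ℝ i G₀ (η, x)‖ * 1 := by
            rw [h1, iteratedFDeriv_prodMk_right hG₀.1]
            exact (ContinuousMultilinearMap.norm_compContinuousLinearMap_le _ _).trans
              (mul_le_mul_of_nonneg_left h3 (norm_nonneg _))
        _ ≤ C * (1 + ‖(η, x)‖) ^ k := by rw [mul_one]; exact hC _
        _ ≤ C * ((1 + |R|) * (1 + ‖η‖)) ^ k := by
            gcongr
            nlinarith [mul_nonneg (abs_nonneg R) (norm_nonneg η)]
        _ ≤ C * ((1 + |R|) ^ k * (2 ^ (k - 1) * (1 ^ k + ‖η‖ ^ k))) := by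
            rw [mul_pow]
            gcongr
            exact add_pow_le zero_le_one (norm_nonneg η) k
        _ = D * (1 + ‖η‖ ^ k) := by rw [hD, one_pow]; ring
    have hbound : Integrable (fun η => D * (‖η‖ ^ 0 * ‖g η‖ + ‖η‖ ^ k * ‖g η‖)) volume :=
      ((g.integrable_pow_mul volume 0).add (g.integrable_pow_mul volume k)).const_mul D
    refine hbound.mono' ((derivMap i).continuous.comp hcont).aestronglyMeasurable
      (Filter.Eventually.of_forall fun η => ?_)
    refine norm_le (by positivity) fun x => ?_
    rw [eval_deriv]
    by_cases hx : x ∈ K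
    · have h4 : iteratedFDeriv ℝ i (Φ η) x = g η • iteratedFDeriv ℝ i (M η) x :=
        iteratedFDeriv_const_smul_apply (a := g η) (f := M η)
          ((modTranslate χ s ((2 * Real.pi) • η)).contDiff.contDiffAt.of_le (by exact_mod_cast le_top))
      rw [h4, norm_smul]
      calc ‖g η‖ * ‖iteratedFDeriv ℝ i (M η) x‖ ≤ ‖g η‖ * (D * (1 + ‖η‖ ^ k)) := by
            gcongr
            exact hMi η x hx
        _ = _ := by ring
    · rw [(Φ η).iteratedFDeriv_zero_on_compl hx]
      simp only [Pi.zero_apply, norm_zero]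
      positivity
  obtain ⟨Ψ, hΨ, hL⟩ := ContDiffMapSupportedIn.exists_integral (μ := volume) (Φ := Φ) hint
  -- Pointwise this is Fourier inversion: integrating g(η) e^{-2πi⟨x,η⟩} recovers h(x).
  have hΨ' : ∀ x, Ψ x = θ x := by
    intro x
    rw [hΨ, hθ, ← hFg, Real.fourier_eq, ← integral_const_mul]
    refine integral_congr_ae (Filter.Eventually.of_forall fun η => ?_)
    change g η * modTranslate χ s ((2 * Real.pi) • η) x =
      χ (x - s) * (Real.fourierChar (-inner ℝ η x) • g η)
    rw [modTranslate_apply, exp_inner_eq_fourierChar, Circle.smul_def, real_inner_comm, smul_eq_mul]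
    ring
  calc ∫ η, FourierTransformInv.fourierInv (h : Rn n → ℂ) η * stft u χ s η
      = ∫ η, u.pairOn K (Φ η) := by
        refine integral_congr_ae (Filter.Eventually.of_forall fun η => ?_)
        change _ = u.pairOn K (Φ η)
        rw [u.pairOn_apply (Φ η) (g η • modTranslate χ s ((2 * Real.pi) • η)) (fun x => rfl),
          u.pair_smul]
        simp only [hg]
        rfl
    _ = u.pairOn K Ψ := (hL _).symm
    _ = u.pair θ := u.pairOn_apply _ _ hΨ'

/-! ### Measurability of the mixed norms and the 2π normalisation. -/

section Norms

theorem exists_conjugate_exponent {p : ℝ≥0∞} (hp : 1 ≤ p) :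
    ∃ q : ℝ≥0∞, 1 ≤ q ∧ p⁻¹ + q⁻¹ = 1 := by
  refine ⟨(1 - p⁻¹)⁻¹, ENNReal.one_le_inv.2 tsub_le_self, ?_⟩
  rw [inv_inv, add_tsub_cancel_of_le (ENNReal.inv_le_one.2 hp)]

theorem Continuous.supLpNorm_lt_top_of_hasCompactSupport {χ : Rn n → ℂ} (hχ : Continuous χ)
    (hc : HasCompactSupport χ) {p : ℝ≥0∞} (hp : 1 ≤ p) :
    supLpNorm p (fun x => ‖χ x‖ₑ) volume < ∞ := by
  by_cases hp' : p = ∞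
  · subst hp'
    rw [supLpNorm_top]
    obtain ⟨C, hC⟩ := hχ.bounded_above_of_compact_support hc
    refine (iSup_le fun x => ?_).trans_lt (ENNReal.ofReal_lt_top (r := C))
    rw [← ofReal_norm]
    exact ENNReal.ofReal_le_ofReal (hC x)
  · rw [supLpNorm_of_ne_top hp',
      ← eLpNorm_eq_lintegral_rpow_enorm_toReal (zero_lt_one.trans_le hp).ne' hp']
    exact (hχ.memLp_of_hasCompactSupport hc).2

/-- At exponent ∞ the supremum is uncountable, but a supremum of continuous functions is lower
semicontinuous. Finite exponents are Tonelli. -/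
theorem Continuous.measurable_supLpNorm {F : Rn n × Rn n → ℂ} (hF : Continuous F) (p : ℝ≥0∞) :
    Measurable fun η => supLpNorm p (fun y => ‖F (y, η)‖ₑ) volume := by
  by_cases hp' : p = ∞
  · subst hp'
    simp only [supLpNorm_top]
    refine (lowerSemicontinuous_iSup fun y => ?_).measurable
    exact (hF.comp (Continuous.prodMk_right y)).enorm.lowerSemicontinuous
  · simp only [supLpNorm_of_ne_top hp']
    exact (hF.enorm.measurable.pow_const _).lintegral_prod_left'.pow_const _

theorem lintegral_two_pi_smul (F : Rn n → ℝ≥0∞) :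
    ∫⁻ η, F ((2 * Real.pi) • η) =
      ENNReal.ofReal |((2 * Real.pi) ^ Module.finrank ℝ (Rn n))⁻¹| * ∫⁻ ξ, F ξ := by
  have hc : (2 * Real.pi) ≠ 0 := by positivity
  have h := Measure.map_addHaar_smul (volume : Measure (Rn n)) hc
  generalize 2 * Real.pi = a at *
  rw [← smul_eq_mul (ENNReal.ofReal _), ← lintegral_smul_measure, ← h]
  exact (lintegral_map_equiv F (Homeomorph.smulOfNeZero _ hc).toMeasurableEquiv).symm

/-- Substituting ξ = 2πη only multiplies the integral by a positive finite constant. -/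
theorem mem_Sw_iff {u : Distr n} {p : ℝ≥0∞} :
    u ∈ Sw n p ↔ ∃ χ : TestFun n, χ ≠ 0 ∧
      ∫⁻ η, supLpNorm p (fun y => ‖stft u χ y η‖ₑ) volume < ∞ := by
  refine exists_congr fun χ => and_congr_right fun _ => ?_
  have h := lintegral_two_pi_smul (windowNorm u χ p)
  change ∫⁻ η, supLpNorm p (fun y => ‖stft u χ y η‖ₑ) volume = _ at h
  have hc : 0 < |((2 * Real.pi) ^ Module.finrank ℝ (Rn n))⁻¹| := by positivity
  rw [h]
  refine ⟨ENNReal.mul_lt_top ENNReal.ofReal_lt_top, fun h0 => ?_⟩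
  exact ENNReal.lt_top_of_mul_ne_top_right h0.ne (ENNReal.ofReal_pos.2 hc).ne'

end Norms

/-! ### Inversion formula: elements of S_w^p as bounded continuous functions. -/

theorem continuous_slice_left {F : Rn n → Rn n → ℂ}
    (hF : Continuous fun z : Rn n × Rn n => F z.1 z.2) (η : Rn n) : Continuous fun y => F y η := by
  have h : Continuous fun y : Rn n => ((y, η) : Rn n × Rn n) := by fun_prop
  exact hF.comp h

theorem continuous_slice_right' {F : Rn n → Rn n → ℂ}
    (hF : Continuous fun z : Rn n × Rn n => F z.1 z.2) (y : Rn n) : Continuous (F y) :=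
  hF.comp (Continuous.prodMk_right y)

theorem continuous_comp_snd {F : Rn n → Rn n → ℂ}
    (hF : Continuous fun z : Rn n × Rn n => F z.1 z.2) :
    Continuous fun w : Rn n × (Rn n × Rn n) => F w.2.1 w.2.2 :=
  hF.comp continuous_snd

theorem continuous_slice_right {k : Rn n → Rn n → Rn n → ℂ}
    (hk : Continuous fun w : Rn n × (Rn n × Rn n) => k w.1 w.2.1 w.2.2) (x : Rn n) :
    Continuous fun w : Rn n × Rn n => k x w.1 w.2 :=
  hk.comp (Continuous.prodMk_right x)

theorem continuous_stft_left (u : Distr n) (χ : TestFun n) (η : Rn n) :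
    Continuous fun y => stft u χ y η :=
  continuous_slice_left (F := stft u χ) (continuous_stft u χ) η

theorem lintegral_window_mul_stft_le (u : Distr n) (χ : TestFun n) {p q : ℝ≥0∞} (hp : 1 ≤ p)
    (hq : 1 ≤ q) (hpq : p⁻¹ + q⁻¹ = 1) (x η : Rn n) :
    ∫⁻ s, ‖χ (x - s)‖ₑ * ‖stft u χ s η‖ₑ ≤ supLpNorm q (fun x => ‖χ x‖ₑ) volume *
      supLpNorm p (fun y => ‖stft u χ y η‖ₑ) volume := by
  rw [← supLpNorm_comp_sub_left (fun x => ‖χ x‖ₑ) x]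
  exact lintegral_mul_le_supLpNorm hq hp (by rw [add_comm]; exact hpq)
    (χ.continuous.comp (by fun_prop)).enorm.measurable (continuous_stft_left u χ η).enorm.measurable

theorem integral_normSq_ne_zero {χ : TestFun n} (hχ : χ ≠ 0) :
    ∫ x, (starRingEnd ℂ (χ x)) * χ x ≠ 0 := by
  have h1 : ∀ x, (starRingEnd ℂ (χ x)) * χ x = ((‖χ x‖ ^ 2 : ℝ) : ℂ) := by
    intro x
    rw [mul_comm, Complex.mul_conj, Complex.normSq_eq_norm_sq]
  simp_rw [h1]
  rw [integral_complex_ofReal]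
  have hcont : Continuous fun x => ‖χ x‖ ^ 2 := χ.continuous.norm.pow 2
  obtain ⟨x₀, hx₀⟩ : ∃ x, χ x ≠ 0 := by
    by_contra! h
    exact hχ (by ext x; exact h x)
  have hpos : 0 < ∫ x, ‖χ x‖ ^ 2 :=
    hcont.integral_pos_of_hasCompactSupport_nonneg_nonzero
      (χ.hasCompactSupport.comp_left (g := fun z : ℂ => ‖z‖ ^ 2) (by simp))
      (fun x => by positivity) (x := x₀) (by simpa using hx₀)
  exact_mod_cast hpos.ne'

/-- The candidate comes from the inversion formula with dual window conj χ / ‖χ‖₂². Besides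
boundedness, the pointwise estimate by S and χ is recorded, because the convergence of convolutions
needs it. -/
theorem exists_boundedContinuous_of_stft (u : Distr n) {χ : TestFun n} (hχ : χ ≠ 0) {p : ℝ≥0∞}
    (hp : 1 ≤ p) (hu : ∫⁻ η, supLpNorm p (fun y => ‖stft u χ y η‖ₑ) volume < ∞) :
    ∃ f : Rn n →ᵇ ℂ, u.IsFun f ∧ ∃ C : ℝ≥0∞, C ≠ ∞ ∧
      ∀ x, ‖f x‖ₑ ≤ C * ∫⁻ η, ∫⁻ s, ‖χ (x - s)‖ₑ * ‖stft u χ s η‖ₑ := by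
  obtain ⟨q, hq, hpq⟩ := exists_conjugate_exponent hp
  set X := supLpNorm q (fun x => ‖χ x‖ₑ) volume with hX
  have hXtop : X < ∞ := χ.continuous.supLpNorm_lt_top_of_hasCompactSupport χ.hasCompactSupport hq
  set N : Rn n → ℝ≥0∞ := fun η => supLpNorm p (fun y => ‖stft u χ y η‖ₑ) volume with hN
  have hNm : Measurable N := (continuous_stft u χ).measurable_supLpNorm p
  set c : ℂ := (∫ x, (starRingEnd ℂ (χ x)) * χ x)⁻¹ with hc
  have hχconj : Continuous fun x => starRingEnd ℂ (χ x) := Complex.continuous_conj.comp χ.continuous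
  let k : Rn n → Rn n → Rn n → ℂ := fun x s η =>
    (Real.fourierChar (inner ℝ x η) : ℂ) * (stft u χ s η * starRingEnd ℂ (χ (x - s)))
  have hk : Continuous fun w : Rn n × (Rn n × Rn n) => k w.1 w.2.1 w.2.2 := by
    have h1 : Continuous fun w : Rn n × (Rn n × Rn n) => stft u χ w.2.1 w.2.2 :=
      continuous_comp_snd (F := stft u χ) (continuous_stft u χ)
    refine Continuous.mul ?_ (h1.mul (hχconj.comp (by fun_prop)))
    exact continuous_subtype_val.comp (Real.continuous_fourierChar.comp (by fun_prop))
  have hknorm : ∀ x s η, ‖k x s η‖ₑ = ‖χ (x - s)‖ₑ * ‖stft u χ s η‖ₑ := by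
    intro x s η
    have h1 : ‖(Real.fourierChar (inner ℝ x η) : ℂ)‖ₑ = 1 := by
      rw [← ofReal_norm, Circle.norm_coe, ENNReal.ofReal_one]
    have h2 : ‖starRingEnd ℂ (χ (x - s))‖ₑ = ‖χ (x - s)‖ₑ := by
      rw [← ofReal_norm, ← ofReal_norm, Complex.norm_conj]
    simp only [k]
    rw [enorm_mul, enorm_mul, h1, h2, one_mul, mul_comm]
  have hkx : ∀ x, Continuous fun w : Rn n × Rn n => k x w.1 w.2 := continuous_slice_right hk
  have hkle : ∀ x η, ∫⁻ s, ‖k x s η‖ₑ ≤ X * N η := by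
    intro x η
    simp_rw [hknorm]
    exact lintegral_window_mul_stft_le u χ hp hq hpq x η
  have hkw : ∀ x, ∫⁻ w : Rn n × Rn n, ‖k x w.1 w.2‖ₑ ∂(volume.prod volume) ≤ X * ∫⁻ η, N η := by
    intro x
    rw [lintegral_prod_symm' _ (hkx x).enorm.measurable,
      ← lintegral_const_mul _ hNm]
    exact lintegral_mono fun η => hkle x η
  have hkint : ∀ x, Integrable (fun w : Rn n × Rn n => k x w.1 w.2) (volume.prod volume) :=
    fun x => ⟨(hkx x).aestronglyMeasurable,
      (hkw x).trans_lt (ENNReal.mul_lt_top hXtop hu)⟩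
  let f₀ : Rn n → ℂ := fun x => c * ∫ η, ∫ s, k x s η
  have hf₀norm : ∀ x, ‖f₀ x‖ₑ ≤ ‖c‖ₑ * ∫⁻ η, ∫⁻ s, ‖χ (x - s)‖ₑ * ‖stft u χ s η‖ₑ := by
    intro x
    rw [enorm_mul]
    gcongr
    refine (enorm_integral_le_lintegral_enorm _).trans (lintegral_mono fun η => ?_)
    refine (enorm_integral_le_lintegral_enorm _).trans (lintegral_mono fun s => ?_)
    rw [hknorm]
  have hf₀bdd : ∀ x, ‖f₀ x‖ₑ ≤ ‖c‖ₑ * (X * ∫⁻ η, N η) := by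
    intro x
    refine (hf₀norm x).trans ?_
    gcongr
    rw [← lintegral_const_mul _ hNm]
    exact lintegral_mono fun η => lintegral_window_mul_stft_le u χ hp hq hpq x η
  have hbtop : ‖c‖ₑ * (X * ∫⁻ η, N η) ≠ ∞ :=
    (ENNReal.mul_lt_top enorm_lt_top (ENNReal.mul_lt_top hXtop hu)).ne
  -- For fixed η the inner integral is a character times a convolution with a continuous compactly
  -- supported function; in η the domination is by `X * N η`.
  have hf₀cont : Continuous f₀ := by
    refine continuous_const.mul ?_
    have hNint : Integrable (fun η => (X * N η).toReal) volume :=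
      integrable_toReal_of_lintegral_ne_top (hNm.const_mul X).aemeasurable
        (by rw [lintegral_const_mul _ hNm]; exact (ENNReal.mul_lt_top hXtop hu).ne)
    refine continuous_of_dominated (bound := fun η => (X * N η).toReal) (fun x => ?_) (fun x => ?_)
      hNint ?_
    · exact ((hkx x).stronglyMeasurable.integral_prod_left
        (μ := volume) (f := fun s η => k x s η)).aestronglyMeasurable
    · filter_upwards [ae_lt_top hNm hu.ne] with η hη
      rw [← toReal_enorm]
      exact ENNReal.toReal_mono (ENNReal.mul_lt_top hXtop hη).ne
        ((enorm_integral_le_lintegral_enorm _).trans (hkle x η))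
    · refine Filter.Eventually.of_forall fun η => ?_
      simp only [k, integral_const_mul]
      refine Continuous.mul (continuous_subtype_val.comp
        (Real.continuous_fourierChar.comp (by fun_prop))) ?_
      exact HasCompactSupport.continuous_convolution_right (ContinuousLinearMap.mul ℂ ℂ)
        (f := fun s => stft u χ s η) (g := fun x => starRingEnd ℂ (χ x))
        (χ.hasCompactSupport.comp_left (by simp))
        (continuous_stft_left u χ η).locallyIntegrable hχconj
  let f : Rn n →ᵇ ℂ := BoundedContinuousFunction.ofNormedAddCommGroup f₀ hf₀cont
    (‖c‖ₑ * (X * ∫⁻ η, N η)).toReal fun x => by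
      rw [← toReal_enorm]
      exact ENNReal.toReal_mono hbtop (hf₀bdd x)
  refine ⟨f, ⟨hf₀cont.locallyIntegrable, fun φ => ?_⟩, ‖c‖ₑ, enorm_ne_top, hf₀norm⟩
  change u φ = ∫ x, (φ x : ℂ) * f₀ x
  let φc : TestFun n := TestFunction.postcompCLM Complex.ofRealCLM φ
  -- The averaging window is |χ|². Then φ|χ(·-s)|² splits as χ(·-s) times `h s`, the form required
  -- by Parseval.
  let ρ : TestFun n := testFunOf (fun x => starRingEnd ℂ (χ x) * χ x)
    ((Complex.conjCLE.contDiff.comp χ.contDiff).mul χ.contDiff) χ.hasCompactSupport.mul_left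
  have hconjs : ∀ s, ContDiff ℝ (((⊤ : ℕ∞) : WithTop ℕ∞))
      (fun x => φc x * starRingEnd ℂ (χ (x - s))) := fun s =>
    φc.contDiff.mul (Complex.conjCLE.contDiff.comp (χ.contDiff.comp (by fun_prop)))
  let h : Rn n → TestFun n := fun s => testFunOf (fun x => φc x * starRingEnd ℂ (χ (x - s)))
    (hconjs s) φc.hasCompactSupport.mul_right
  let Φ : Rn n → TestFun n := fun s => testFunOf (fun x => φc x * ρ (x - s))
    (φc.contDiff.mul (ρ.contDiff.comp (by fun_prop))) φc.hasCompactSupport.mul_right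
  have h1 := integral_pair_mul_translate u φc ρ Φ fun s x => rfl
  have h2 : ∀ s, u.pair (Φ s) = ∫ η, ∫ x, φc x * k x s η := by
    intro s
    rw [← integral_fourierInv_mul_stft u χ s (h s) (Φ s) fun x => by
      change φc x * (starRingEnd ℂ (χ (x - s)) * χ (x - s)) =
        χ (x - s) * (φc x * starRingEnd ℂ (χ (x - s)))
      ring]
    refine integral_congr_ae (Filter.Eventually.of_forall fun η => ?_)
    simp only
    rw [Real.fourierInv_eq, ← integral_mul_const]
    refine integral_congr_ae (Filter.Eventually.of_forall fun x => ?_)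
    change Real.fourierChar (inner ℝ x η) • (φc x * starRingEnd ℂ (χ (x - s))) * stft u χ s η =
      φc x * ((Real.fourierChar (inner ℝ x η) : ℂ) * (stft u χ s η * starRingEnd ℂ (χ (x - s))))
    rw [Circle.smul_def, smul_eq_mul]
    ring
  -- Absolute integrability over (x, s, η) licenses the interchanges that match the averaged
  -- Parseval formula with ∫ φ f₀.
  have hQ : Integrable (fun w : Rn n × (Rn n × Rn n) => φc w.1 * k w.1 w.2.1 w.2.2)
      (volume.prod (volume.prod volume)) := by
    have hcontQ : Continuous fun w : Rn n × (Rn n × Rn n) => φc w.1 * k w.1 w.2.1 w.2.2 :=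
      (φc.continuous.comp continuous_fst).mul hk
    refine ⟨hcontQ.aestronglyMeasurable, ?_⟩
    rw [hasFiniteIntegral_iff_enorm, lintegral_prod _ hcontQ.enorm.measurable.aemeasurable]
    have h3 : ∀ x, ∫⁻ w : Rn n × Rn n, ‖φc x * k x w.1 w.2‖ₑ ∂(volume.prod volume) ≤
        ‖φc x‖ₑ * (X * ∫⁻ η, N η) := by
      intro x
      simp_rw [enorm_mul]
      rw [lintegral_const_mul _ (hkx x).enorm.measurable]
      gcongr
      exact hkw x
    refine (lintegral_mono h3).trans_lt ?_
    rw [lintegral_mul_const _ φc.continuous.enorm.measurable]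
    exact ENNReal.mul_lt_top
      (φc.continuous.integrable_of_hasCompactSupport φc.hasCompactSupport).2
      (ENNReal.mul_lt_top hXtop hu)
  have h4 : ∫ x, φc x * f₀ x = c * ∫ s, ∫ η, ∫ x, φc x * k x s η := by
    calc ∫ x, φc x * f₀ x
        = c * ∫ x, ∫ w : Rn n × Rn n, φc x * k x w.1 w.2 ∂(volume.prod volume) := by
          rw [← integral_const_mul]
          refine integral_congr_ae (Filter.Eventually.of_forall fun x => ?_)
          simp only [f₀]
          rw [integral_const_mul, integral_prod_symm _ (hkint x)]
          ring
      _ = c * ∫ s, ∫ η, ∫ x, φc x * k x s η := by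
          rw [integral_integral_swap (f := fun x (w : Rn n × Rn n) => φc x * k x w.1 w.2) hQ,
            integral_prod _ hQ.integral_prod_right]
  change u φ = ∫ x, φc x * f₀ x
  rw [h4, ← u.pair_ofReal φ]
  simp_rw [← h2]
  rw [h1, ← mul_assoc]
  change u.pair φc = c * (∫ x, (starRingEnd ℂ (χ x)) * χ x) * u.pair φc
  rw [hc, inv_mul_cancel₀ (integral_normSq_ne_zero hχ), one_mul]

/-! ### Products: convolution of local Fourier transforms in the frequency. -/

section Products

open FourierTransform

theorem enorm_fourierChar_mul (t : ℝ) (z : ℂ) : ‖(Real.fourierChar t : ℂ) * z‖ₑ = ‖z‖ₑ := by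
  rw [enorm_mul, ← ofReal_norm (Real.fourierChar t : ℂ), Circle.norm_coe, ENNReal.ofReal_one,
    one_mul]

/-- The Fourier transform of a product is dominated by a convolution. -/
theorem enorm_fourier_mul_le {F G : Rn n → ℂ} (hFc : Continuous F) (hF : Integrable F volume)
    (hFF : Integrable (𝓕 F) volume) (hG : Integrable G volume) (η : Rn n) :
    ‖𝓕 (fun x => F x * G x) η‖ₑ ≤ ∫⁻ ζ, ‖𝓕 F ζ‖ₑ * ‖𝓕 G (η - ζ)‖ₑ := by
  -- The kernel results from inserting Fourier inversion for `F`; only `F` needs an integrable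
  -- transform, `G` need only be integrable.
  let K : Rn n → Rn n → ℂ := fun x ζ =>
    (Real.fourierChar (inner ℝ x (ζ - η)) : ℂ) * (G x * 𝓕 F ζ)
  have hK : Integrable (Function.uncurry K) (volume.prod volume) := by
    have h1 := hG.mul_prod hFF
    have hc : Continuous fun z : Rn n × Rn n => (Real.fourierChar (inner ℝ z.1 (z.2 - η)) : ℂ) :=
      continuous_subtype_val.comp (Real.continuous_fourierChar.comp (by fun_prop))
    refine h1.mono (hc.aestronglyMeasurable.mul h1.aestronglyMeasurable) ?_
    refine Filter.Eventually.of_forall fun z => ?_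
    simp only [Function.uncurry, K]
    rw [norm_mul, Circle.norm_coe, one_mul]
  have h1 : 𝓕 (fun x => F x * G x) η = ∫ x, ∫ ζ, K x ζ := by
    rw [Real.fourier_eq]
    refine integral_congr_ae (Filter.Eventually.of_forall fun x => ?_)
    change Real.fourierChar (-inner ℝ x η) • (F x * G x) = ∫ ζ, K x ζ
    have h2 : F x = ∫ ζ, Real.fourierChar (inner ℝ ζ x) • 𝓕 F ζ := by
      rw [← Real.fourierInv_eq, hFc.fourierInv_fourier_eq hF hFF]
    conv_lhs => rw [h2]
    rw [Circle.smul_def, smul_eq_mul, ← integral_mul_const, ← integral_const_mul]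
    refine integral_congr_ae (Filter.Eventually.of_forall fun ζ => ?_)
    simp only [K]
    rw [inner_sub_right, sub_eq_add_neg, AddChar.map_add_eq_mul, Circle.coe_mul, Circle.smul_def,
      smul_eq_mul, real_inner_comm x ζ]
    ring
  have h3 : ∀ ζ, ∫ x, K x ζ = 𝓕 F ζ * 𝓕 G (η - ζ) := by
    intro ζ
    rw [Real.fourier_eq G, ← integral_const_mul]
    refine integral_congr_ae (Filter.Eventually.of_forall fun x => ?_)
    simp only [K]
    rw [← inner_neg_right, neg_sub, Circle.smul_def, smul_eq_mul]
    ring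
  rw [h1, integral_integral_swap hK]
  refine (enorm_integral_le_lintegral_enorm _).trans (lintegral_mono fun ζ => ?_)
  rw [h3, enorm_mul]

theorem Distr.IsFun.stft_eq_fourier {u : Distr n} {f : Rn n → ℂ} (h : u.IsFun f) (χ : TestFun n)
    (y : Rn n) : stft u χ y = 𝓕 (fun x => χ (x - y) * f x) := by
  ext η
  rw [stft, localFourier, h.pair_eq, Real.fourier_eq]
  refine integral_congr_ae (Filter.Eventually.of_forall fun x => ?_)
  simp only
  rw [modTranslate_apply, exp_inner_eq_fourierChar, Circle.smul_def, smul_eq_mul, mul_assoc]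

/-- The product window lets each function keep its own localisation. Finiteness at `y` supplies the
integrable transform, and continuity of `f` makes inversion hold pointwise. -/
theorem Distr.IsFun.enorm_stft_mul_le {u v w : Distr n} {f g : Rn n → ℂ} (hu : u.IsFun f)
    (hv : v.IsFun g) (hw : w.IsFun fun x => f x * g x) (hf : Continuous f)
    {χ₁ χ₂ χ : TestFun n} (hχ : ∀ x, χ x = χ₁ x * χ₂ x) {y : Rn n}
    (hy : ∫⁻ ζ, ‖stft u χ₁ y ζ‖ₑ < ∞) (η : Rn n) :
    ‖stft w χ y η‖ₑ ≤ ∫⁻ ζ, ‖stft u χ₁ y ζ‖ₑ * ‖stft v χ₂ y (η - ζ)‖ₑ := by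
  have hcs : ∀ ψ : TestFun n, HasCompactSupport fun x => ψ (x - y) := fun ψ =>
    ψ.hasCompactSupport.comp_homeomorph (Homeomorph.subRight y)
  have hct : ∀ ψ : TestFun n, Continuous fun x => ψ (x - y) := fun ψ =>
    ψ.continuous.comp (by fun_prop)
  have h1 : stft w χ y η = 𝓕 (fun x => (χ₁ (x - y) * f x) * (χ₂ (x - y) * g x)) η := by
    rw [hw.stft_eq_fourier]
    refine congrArg (fun F : Rn n → ℂ => (𝓕 F : Rn n → ℂ) η) (funext fun x => ?_)
    rw [hχ]
    ring
  rw [h1, hv.stft_eq_fourier]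
  have hS : Continuous (stft u χ₁ y) :=
    continuous_slice_right' (F := stft u χ₁) (continuous_stft u χ₁) y
  have hSint : Integrable (stft u χ₁ y) volume := ⟨hS.aestronglyMeasurable, hy⟩
  rw [hu.stft_eq_fourier] at hSint ⊢
  exact enorm_fourier_mul_le ((hct χ₁).mul hf) (hu.integrable_mul (hct χ₁) (hcs χ₁)) hSint
    (hv.integrable_mul (hct χ₂) (hcs χ₂)) η

/-- Moving the window only shifts y, which leaves the norms in y unchanged. Hence windows may be
moved until they overlap. -/
theorem exists_stft_translate (u : Distr n) (χ : TestFun n) (z : Rn n) :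
    ∃ χ' : TestFun n, (∀ x, χ' x = χ (x - z)) ∧ ∀ y η, stft u χ' y η = stft u χ (y + z) η := by
  refine ⟨testFunOf (fun x => χ (x - z)) (χ.contDiff.comp (by fun_prop))
    (χ.hasCompactSupport.comp_homeomorph (Homeomorph.subRight z)), fun x => rfl, fun y η => ?_⟩
  unfold stft localFourier
  congr 1
  ext x
  change _ * χ (x - y - z) = _ * χ (x - (y + z))
  rw [sub_sub]

theorem ae_lt_top_of_supLpNorm_lt_top {p : ℝ≥0∞} {h : Rn n → ℝ≥0∞} (hp : 1 ≤ p)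
    (hp' : p ≠ ∞) (hh : Measurable h) (hfin : supLpNorm p h volume < ∞) :
    ∀ᵐ y, h y < ∞ := by
  have hp1 := one_le_toReal_of_one_le hp hp'
  rw [supLpNorm_of_ne_top hp', ENNReal.rpow_lt_top_iff_of_pos (by positivity)] at hfin
  filter_upwards [ae_lt_top (hh.pow_const _) hfin.ne] with y hy
  exact (ENNReal.rpow_lt_top_iff_of_pos (by positivity)).1 hy

theorem supLpNorm_lintegral_le_swap {S : Rn n → Rn n → ℝ≥0∞} {p : ℝ≥0∞} (hp : 1 ≤ p)
    (hS : Measurable (Function.uncurry S)) :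
    supLpNorm p (fun y => ∫⁻ ζ, S y ζ) volume ≤ ∫⁻ ζ, supLpNorm p (fun y => S y ζ) volume :=
  supLpNorm_lintegral_le (F := fun ζ y => S y ζ) hp (hS.comp measurable_swap)

/-- Minkowski moves the norm inside the ζ-integral, Hölder splits it, and what remains is the
integral of a convolution of two nonnegative functions of the frequency. -/
theorem lintegral_supLpNorm_convolution_le {S T : Rn n → Rn n → ℝ≥0∞} {p q r : ℝ≥0∞}
    (hp : 1 ≤ p) (hq : 1 ≤ q) (hr : 1 ≤ r) (hpqr : p⁻¹ + q⁻¹ = r⁻¹)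
    (hS : Measurable (Function.uncurry S)) (hT : Measurable (Function.uncurry T))
    (hSp : Measurable fun ζ => supLpNorm p (fun y => S y ζ) volume)
    (hTq : Measurable fun ζ => supLpNorm q (fun y => T y ζ) volume) :
    ∫⁻ η, supLpNorm r (fun y => ∫⁻ ζ, S y ζ * T y (η - ζ)) volume ≤
      (∫⁻ ζ, supLpNorm p (fun y => S y ζ) volume) *
        ∫⁻ η, supLpNorm q (fun y => T y η) volume := by
  set Nu : Rn n → ℝ≥0∞ := fun η => supLpNorm p (fun y => S y η) volume with hNu
  set Nv : Rn n → ℝ≥0∞ := fun η => supLpNorm q (fun y => T y η) volume with hNv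
  calc ∫⁻ η, supLpNorm r (fun y => ∫⁻ ζ, S y ζ * T y (η - ζ)) volume
      ≤ ∫⁻ η, ∫⁻ ζ, Nu ζ * Nv (η - ζ) := by
        refine lintegral_mono fun η => ?_
        refine (supLpNorm_lintegral_le_swap (S := fun y ζ => S y ζ * T y (η - ζ)) hr ?_).trans ?_
        · exact hS.mul (hT.comp (measurable_fst.prodMk (measurable_const.sub measurable_snd)))
        · refine lintegral_mono fun ζ => supLpNorm_mul_le hp hq hr hpqr ?_ ?_
          · exact hS.comp (measurable_id.prodMk measurable_const)
          · exact hT.comp (measurable_id.prodMk measurable_const)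
    _ = ∫⁻ ζ, ∫⁻ η, Nu ζ * Nv (η - ζ) := by
        refine lintegral_lintegral_swap (Measurable.aemeasurable ?_)
        exact (hSp.comp measurable_snd).mul (hTq.comp (measurable_fst.sub measurable_snd))
    _ = (∫⁻ ζ, Nu ζ) * ∫⁻ η, Nv η := by
        rw [← lintegral_mul_const _ hSp]
        refine lintegral_congr fun ζ => ?_
        have h1 : Measurable fun η => Nv (η - ζ) := hTq.comp (measurable_id.sub_const ζ)
        rw [lintegral_const_mul _ h1,
          lintegral_sub_right_eq_self Nv ζ]

theorem mul_mem_Sw {u v w : Distr n} {f g : Rn n → ℂ} {p q r : ℝ≥0∞} (hp : 1 ≤ p) (hq : 1 ≤ q)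
    (hr : 1 ≤ r) (hpqr : p⁻¹ + q⁻¹ = r⁻¹) (hu : u.IsFun f) (hv : v.IsFun g)
    (hw : w.IsFun fun x => f x * g x) (hf : Continuous f) (hup : u ∈ Sw n p) (hvq : v ∈ Sw n q) :
    w ∈ Sw n r := by
  obtain ⟨χ₁, hχ₁, hN₁⟩ := mem_Sw_iff.1 hup
  obtain ⟨χ₀, hχ₀, hN₀⟩ := mem_Sw_iff.1 hvq
  have hne : ∀ ψ : TestFun n, ψ ≠ 0 → ∃ x, ψ x ≠ 0 := fun ψ hψ => by
    by_contra! h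
    exact hψ (by ext x; exact h x)
  obtain ⟨a, ha⟩ := hne χ₁ hχ₁
  obtain ⟨b, hb⟩ := hne χ₀ hχ₀
  -- The shift a - b makes χ₂(a) = χ₀(b), so the product window is nonzero at `a`.
  obtain ⟨χ₂, hχ₂, hst⟩ := exists_stft_translate v χ₀ (a - b)
  set Nu : Rn n → ℝ≥0∞ := fun η => supLpNorm p (fun y => ‖stft u χ₁ y η‖ₑ) volume with hNu
  set Nv : Rn n → ℝ≥0∞ := fun η => supLpNorm q (fun y => ‖stft v χ₂ y η‖ₑ) volume with hNv
  have hNvfin : ∫⁻ η, Nv η < ∞ := by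
    refine lt_of_eq_of_lt (lintegral_congr fun η => ?_) hN₀
    simp only [hNv, hst]
    exact supLpNorm_comp_add_right (fun y => ‖stft v χ₀ y η‖ₑ) (a - b)
  have hmu : Measurable (Function.uncurry fun y ζ => ‖stft u χ₁ y ζ‖ₑ) :=
    (continuous_stft u χ₁).enorm.measurable
  have hmv : Measurable (Function.uncurry fun y ζ => ‖stft v χ₂ y ζ‖ₑ) :=
    (continuous_stft v χ₂).enorm.measurable
  have hmNu : Measurable Nu := (continuous_stft u χ₁).measurable_supLpNorm p
  have hmNv : Measurable Nv := (continuous_stft v χ₂).measurable_supLpNorm q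
  have hmink : supLpNorm p (fun y => ∫⁻ ζ, ‖stft u χ₁ y ζ‖ₑ) volume < ∞ :=
    (supLpNorm_lintegral_le_swap hp hmu).trans_lt hN₁
  let χ : TestFun n := testFunOf (fun x => χ₁ x * χ₂ x) (χ₁.contDiff.mul χ₂.contDiff)
    χ₁.hasCompactSupport.mul_right
  have hχ : χ ≠ 0 := by
    intro h
    have h1 : χ₁ a * χ₂ a = 0 := congrArg (fun ψ : TestFun n => ψ a) h
    rw [hχ₂, sub_sub_cancel] at h1
    exact mul_ne_zero ha hb h1
  have hpt : ∀ y, ∫⁻ ζ, ‖stft u χ₁ y ζ‖ₑ < ∞ → ∀ η,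
      ‖stft w χ y η‖ₑ ≤ ∫⁻ ζ, ‖stft u χ₁ y ζ‖ₑ * ‖stft v χ₂ y (η - ζ)‖ₑ := fun y hy η =>
    hu.enorm_stft_mul_le hv hw hf (fun x => rfl) hy η
  -- By Minkowski the transform of `u` is integrable in the frequency for every y if p = ∞ and for
  -- a.e. y otherwise. In the latter case r is finite too, so a null set of y does no harm.
  have hptr : ∀ η, supLpNorm r (fun y => ‖stft w χ y η‖ₑ) volume ≤
      supLpNorm r (fun y => ∫⁻ ζ, ‖stft u χ₁ y ζ‖ₑ * ‖stft v χ₂ y (η - ζ)‖ₑ) volume := by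
    intro η
    by_cases hp' : p = ∞
    · subst hp'
      rw [supLpNorm_top] at hmink
      exact supLpNorm_mono fun y => hpt y ((le_iSup (fun y => ∫⁻ ζ, ‖stft u χ₁ y ζ‖ₑ)
        y).trans_lt hmink) η
    · have hr' : r ≠ ∞ := by
        rintro rfl
        rw [ENNReal.inv_top, add_eq_zero, ENNReal.inv_eq_zero] at hpqr
        exact hp' hpqr.1
      refine supLpNorm_mono_ae hr' ?_
      filter_upwards [ae_lt_top_of_supLpNorm_lt_top hp hp'
        (Measurable.lintegral_prod_right hmu) hmink] with y hy
      exact hpt y hy η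
  refine mem_Sw_iff.2 ⟨χ, hχ, ?_⟩
  exact (lintegral_mono hptr).trans_lt ((lintegral_supLpNorm_convolution_le hp hq hr hpqr hmu hmv
    hmNu hmNv).trans_lt (ENNReal.mul_lt_top hN₁ hNvfin))

end Products

/-! ### Convolutions with L^q functions. -/

section Convolutions

/-- For q = ∞ a representative of |v| is truncated at its essential supremum, so that the true
supremum becomes finite. -/
theorem MeasureTheory.MemLp.exists_supLpNorm_lt_top {v : Rn n → ℂ} {q : ℝ≥0∞} (hq : 1 ≤ q)
    (hv : MemLp v q volume) : ∃ k : Rn n → ℝ≥0∞, Measurable k ∧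
      (fun x => ‖v x‖ₑ) =ᵐ[volume] k ∧ supLpNorm q k volume < ∞ := by
  obtain ⟨v', hv', hvv'⟩ := hv.1
  have hm : Measurable fun x => ‖v' x‖ₑ := hv'.enorm
  have hae : (fun x => ‖v x‖ₑ) =ᵐ[volume] fun x => ‖v' x‖ₑ := by
    filter_upwards [hvv'] with x hx
    rw [hx]
  have hfin : eLpNorm v' q volume < ∞ := by
    rw [← eLpNorm_congr_ae hvv']
    exact hv.2
  by_cases hq' : q = ∞
  · subst hq'
    rw [eLpNorm_exponent_top] at hfin
    refine ⟨fun x => min ‖v' x‖ₑ (eLpNormEssSup v' volume), hm.min measurable_const, ?_, ?_⟩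
    · filter_upwards [hae, enorm_ae_le_eLpNormEssSup v' volume] with x hx hx'
      rw [hx, min_eq_left hx']
    · rw [supLpNorm_top]
      exact (iSup_le fun x => min_le_right _ _).trans_lt hfin
  · refine ⟨fun x => ‖v' x‖ₑ, hm, hae, ?_⟩
    rwa [supLpNorm_of_ne_top hq',
      ← eLpNorm_eq_lintegral_rpow_enorm_toReal (zero_lt_one.trans_le hq).ne' hq']

/-- The dual exponents in Young's inequality. -/
theorem young_exponent_dual {p q r q' t : ℝ≥0∞} (hq : 1 ≤ q) (hr : 1 ≤ r)
    (hpqr : p⁻¹ + q⁻¹ = 1 + r⁻¹) (hq' : q⁻¹ + q'⁻¹ = 1) (ht : r⁻¹ + t⁻¹ = 1) :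
    t⁻¹ + p⁻¹ = 1 + q'⁻¹ := by
  have hfin : q⁻¹ + r⁻¹ ≠ ∞ := ENNReal.add_ne_top.2
    ⟨((ENNReal.inv_le_one.2 hq).trans_lt ENNReal.one_lt_top).ne,
      ((ENNReal.inv_le_one.2 hr).trans_lt ENNReal.one_lt_top).ne⟩
  -- Adding the finite 1/q + 1/r to both sides avoids truncated subtraction.
  refine (ENNReal.add_left_inj hfin).1 ?_
  calc t⁻¹ + p⁻¹ + (q⁻¹ + r⁻¹) = (r⁻¹ + t⁻¹) + (p⁻¹ + q⁻¹) := by ring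
    _ = 1 + (q⁻¹ + q'⁻¹) + r⁻¹ := by rw [hpqr, ht, hq']; ring
    _ = 1 + q'⁻¹ + (q⁻¹ + r⁻¹) := by ring

/-- For each η, Young places S(·,η) * X in L^{q'}, since 1/t + 1/p = 1 + 1/q'. Hölder against k in
L^q then gives a bound independent of x, which is integrated in η. -/
theorem lintegral_mul_le_of_le_lintegral {S : Rn n → Rn n → ℝ≥0∞} {k f X : Rn n → ℝ≥0∞}
    {C : ℝ≥0∞} (hS : Measurable (Function.uncurry S)) (hk : Measurable k) (hX : Measurable X)
    (hfC : ∀ x, f x ≤ C * ∫⁻ η, ∫⁻ s, X (x - s) * S s η) {p q r q' t : ℝ≥0∞} (hp : 1 ≤ p)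
    (hq : 1 ≤ q) (hq' : 1 ≤ q') (ht : 1 ≤ t) (hr : 1 ≤ r) (hpqr : p⁻¹ + q⁻¹ = 1 + r⁻¹)
    (hqq' : q⁻¹ + q'⁻¹ = 1) (hrt : r⁻¹ + t⁻¹ = 1)
    (hSp : Measurable fun η => supLpNorm p (fun y => S y η) volume) (x : Rn n) :
    ∫⁻ y, k y * f (x - y) ≤ C * (supLpNorm q k volume * supLpNorm t X volume *
      ∫⁻ η, supLpNorm p (fun y => S y η) volume) := by
  have hexp := young_exponent_dual hq hr hpqr hqq' hrt
  let h : Rn n → Rn n → ℝ≥0∞ := fun η a => ∫⁻ s, S s η * X (a - s)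
  have hm : Measurable (Function.uncurry h) := by
    refine Measurable.lintegral_prod_right'
      (f := fun w : (Rn n × Rn n) × Rn n => S w.2 w.1.1 * X (w.1.2 - w.2)) ?_
    exact (hS.comp (measurable_snd.prodMk measurable_fst.fst)).mul
      (hX.comp (measurable_fst.snd.sub measurable_snd))
  have hhle : ∀ η, supLpNorm q' (h η) volume ≤
      supLpNorm p (fun y => S y η) volume * supLpNorm t X volume := fun η =>
    supLpNorm_convolution_le ht hp hq' hexp (hS.comp (measurable_id.prodMk measurable_const)) hX
  have hmx : Measurable (Function.uncurry fun y η => k y * h η (x - y)) :=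
    (hk.comp measurable_fst).mul
      (hm.comp (measurable_snd.prodMk (measurable_const.sub measurable_fst)))
  calc ∫⁻ y, k y * f (x - y)
      ≤ ∫⁻ y, C * ∫⁻ η, k y * h η (x - y) := by
        refine lintegral_mono fun y => ?_
        have hmy : Measurable fun η => h η (x - y) := hm.comp (measurable_id.prodMk measurable_const)
        rw [lintegral_const_mul _ hmy, mul_left_comm]
        refine mul_le_mul_right ((hfC (x - y)).trans_eq ?_) _
        simp only [h, mul_comm (S _ _)]
    _ = C * ∫⁻ y, ∫⁻ η, k y * h η (x - y) := lintegral_const_mul _ hmx.lintegral_prod_right'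
    _ = C * ∫⁻ η, ∫⁻ y, k y * h η (x - y) := by
        rw [lintegral_lintegral_swap hmx.aemeasurable]
    _ ≤ C * ∫⁻ η, supLpNorm q k volume * supLpNorm t X volume *
          supLpNorm p (fun y => S y η) volume := by
        refine mul_le_mul_right (lintegral_mono fun η => ?_) _
        have hmη : Measurable (h η) := hm.comp (measurable_const.prodMk measurable_id)
        have hmη' : Measurable fun y => h η (x - y) :=
          hmη.comp (measurable_const.sub measurable_id)
        refine (lintegral_mul_le_supLpNorm hq hq' hqq' hk hmη').trans ?_
        rw [supLpNorm_comp_sub_left (h η) x, mul_assoc, mul_comm (supLpNorm t X volume)]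
        exact mul_le_mul_right (hhle η) _
    _ = _ := by rw [lintegral_const_mul _ hSp]

theorem exists_lintegral_mul_le (u : Distr n) (χ : TestFun n) {f : Rn n → ℂ} {C : ℝ≥0∞}
    (hC : C ≠ ∞) (hfC : ∀ x, ‖f x‖ₑ ≤ C * ∫⁻ η, ∫⁻ s, ‖χ (x - s)‖ₑ * ‖stft u χ s η‖ₑ)
    {p q r : ℝ≥0∞} (hp : 1 ≤ p) (hq : 1 ≤ q) (hr : 1 ≤ r) (hpqr : p⁻¹ + q⁻¹ = 1 + r⁻¹)
    (hu : ∫⁻ η, supLpNorm p (fun y => ‖stft u χ y η‖ₑ) volume < ∞)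
    {k : Rn n → ℝ≥0∞} (hk : Measurable k) (hkq : supLpNorm q k volume < ∞) :
    ∃ M : ℝ≥0∞, M ≠ ∞ ∧ ∀ x, ∫⁻ y, k y * ‖f (x - y)‖ₑ ≤ M := by
  obtain ⟨q', hq', hqq'⟩ := exists_conjugate_exponent hq
  obtain ⟨t, ht, hrt⟩ := exists_conjugate_exponent hr
  have hSm : Measurable (Function.uncurry fun s η => ‖stft u χ s η‖ₑ) :=
    (continuous_stft u χ).enorm.measurable
  refine ⟨_, ?_, lintegral_mul_le_of_le_lintegral (f := fun x => ‖f x‖ₑ)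
    (S := fun s η => ‖stft u χ s η‖ₑ) (X := fun x => ‖χ x‖ₑ) hSm hk
    χ.continuous.enorm.measurable hfC hp hq hq' ht hr hpqr hqq' hrt
    ((continuous_stft u χ).measurable_supLpNorm p)⟩
  exact (ENNReal.mul_lt_top hC.lt_top (ENNReal.mul_lt_top (ENNReal.mul_lt_top hkq
    (χ.continuous.supLpNorm_lt_top_of_hasCompactSupport χ.hasCompactSupport ht)) hu)).ne

/-- Translating f by z moves the window from y to y - z and produces a unimodular factor.
Integrating against v bounds the transform of v * f; the uniform bound `M` justifies Fubini. -/
theorem Distr.IsFun.enorm_stft_convolution_le {u w : Distr n} {v f : Rn n → ℂ}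
    (hv : AEStronglyMeasurable v volume) (hf : Continuous f) (hu : u.IsFun f) {M : ℝ≥0∞}
    (hM : M ≠ ∞) (hvf : ∀ x, ∫⁻ y, ‖v y‖ₑ * ‖f (x - y)‖ₑ ≤ M)
    (hw : w.IsFun (v ⋆[ContinuousLinearMap.mul ℂ ℂ, volume] f)) (χ : TestFun n) (y η : Rn n) :
    ‖stft w χ y η‖ₑ ≤ ∫⁻ z, ‖v z‖ₑ * ‖stft u χ (y - z) η‖ₑ := by
  let φ : TestFun n := modTranslate χ y ((2 * Real.pi) • η)
  have hint : Integrable (Function.uncurry fun x z => φ x * (v z * f (x - z)))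
      (volume.prod volume) := by
    have hmeas : AEStronglyMeasurable (fun a : Rn n × Rn n => φ a.1 * (v a.2 * f (a.1 - a.2)))
        (volume.prod volume) :=
      ((φ.continuous.comp continuous_fst).aestronglyMeasurable).mul
        (hv.comp_snd.mul (hf.comp (continuous_fst.sub continuous_snd)).aestronglyMeasurable)
    refine ⟨hmeas, ?_⟩
    rw [hasFiniteIntegral_iff_enorm]
    simp only [Function.uncurry]
    rw [lintegral_prod _ hmeas.enorm]
    have h1 : ∀ x, ∫⁻ z, ‖φ x * (v z * f (x - z))‖ₑ ≤ ‖φ x‖ₑ * M := by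
      intro x
      simp_rw [enorm_mul]
      rw [lintegral_const_mul' _ _ enorm_ne_top]
      exact mul_le_mul_right (hvf x) _
    refine (lintegral_mono h1).trans_lt ?_
    rw [lintegral_mul_const _ φ.continuous.enorm.measurable]
    exact ENNReal.mul_lt_top
      (φ.continuous.integrable_of_hasCompactSupport φ.hasCompactSupport).2 hM.lt_top
  have h1 : stft w χ y η = ∫ x, ∫ z, φ x * (v z * f (x - z)) := by
    rw [stft, localFourier, hw.pair_eq]
    refine integral_congr_ae (Filter.Eventually.of_forall fun x => ?_)
    simp only [convolution_def, ContinuousLinearMap.mul_apply']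
    rw [integral_const_mul]
  have h2 : ∀ z, ∫ x, φ x * (v z * f (x - z)) =
      v z * ((Real.fourierChar (-inner ℝ z η) : ℂ) * stft u χ (y - z) η) := by
    intro z
    rw [← integral_add_right_eq_self _ z, stft, localFourier, hu.pair_eq, ← integral_const_mul,
      ← integral_const_mul]
    refine integral_congr_ae (Filter.Eventually.of_forall fun x => ?_)
    simp only [φ]
    rw [modTranslate_apply, modTranslate_apply, exp_inner_eq_fourierChar, exp_inner_eq_fourierChar,
      inner_add_left, neg_add, AddChar.map_add_eq_mul, Circle.coe_mul, add_sub_cancel_right,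
      show x + z - y = x - (y - z) by abel]
    ring
  rw [h1, integral_integral_swap hint]
  refine (enorm_integral_le_lintegral_enorm _).trans (lintegral_mono fun z => ?_)
  rw [h2, enorm_mul, enorm_fourierChar_mul]

theorem exists_convolution_mem_Sw {p q r : ℝ≥0∞} (hp : 1 ≤ p) (hq : 1 ≤ q) (hr : 1 ≤ r)
    (hpqr : p⁻¹ + q⁻¹ = 1 + r⁻¹) {v : Rn n → ℂ} (hv : MemLp v q volume) {u : Distr n}
    (hu : u ∈ Sw n p) :
    ∃ f : Rn n →ᵇ ℂ, u.IsFun f ∧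
      ConvolutionExists v f (ContinuousLinearMap.mul ℂ ℂ) volume ∧
      ∃ w ∈ Sw n r, w.IsFun (v ⋆[ContinuousLinearMap.mul ℂ ℂ, volume] (f : Rn n → ℂ)) := by
  obtain ⟨χ, hχ, hN⟩ := mem_Sw_iff.1 hu
  obtain ⟨f, huf, C, hC, hfC⟩ := exists_boundedContinuous_of_stft u hχ hp hN
  obtain ⟨k, hk, hvk, hkq⟩ := hv.exists_supLpNorm_lt_top hq
  obtain ⟨M, hM, hkM⟩ := exists_lintegral_mul_le u χ hC hfC hp hq hr hpqr hN hk hkq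
  -- Under the integral |v| may be replaced by `k`, whose true-supremum norm is finite, as Young's
  -- inequality in the form above requires.
  have hswap : ∀ a : Rn n → ℝ≥0∞, ∫⁻ y, ‖v y‖ₑ * a y = ∫⁻ y, k y * a y := fun a =>
    lintegral_congr_ae (by filter_upwards [hvk] with y hy; rw [hy])
  have hvf : ∀ x, ∫⁻ y, ‖v y‖ₑ * ‖f (x - y)‖ₑ ≤ M := fun x => (hswap _).trans_le (hkM x)
  have hconv : ConvolutionExists v f (ContinuousLinearMap.mul ℂ ℂ) volume := by
    intro x
    refine ⟨hv.1.mul (f.continuous.comp (by fun_prop)).aestronglyMeasurable, ?_⟩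
    rw [hasFiniteIntegral_iff_enorm]
    simp only [ContinuousLinearMap.mul_apply', enorm_mul]
    exact (hvf x).trans_lt hM.lt_top
  have hmeas : AEStronglyMeasurable (v ⋆[ContinuousLinearMap.mul ℂ ℂ, volume] (f : Rn n → ℂ))
      volume :=
    (hv.1.convolution_integrand (ContinuousLinearMap.mul ℂ ℂ)
      f.continuous.aestronglyMeasurable).integral_prod_right'
  have hbdd : ∀ x, ‖(v ⋆[ContinuousLinearMap.mul ℂ ℂ, volume] (f : Rn n → ℂ)) x‖ ≤ M.toReal := by
    intro x
    rw [← toReal_enorm]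
    refine ENNReal.toReal_mono hM ((enorm_integral_le_lintegral_enorm _).trans ?_)
    simp only [ContinuousLinearMap.mul_apply', enorm_mul]
    exact hvf x
  have hloc : LocallyIntegrable (v ⋆[ContinuousLinearMap.mul ℂ ℂ, volume] (f : Rn n → ℂ))
      volume :=
    (memLp_top_of_bound hmeas _ (Filter.Eventually.of_forall hbdd)).locallyIntegrable le_top
  obtain ⟨w, hw⟩ := Distr.exists_isFun hloc
  -- The window of `u` serves unchanged for the convolution.
  refine ⟨f, huf, hconv, w, mem_Sw_iff.2 ⟨χ, hχ, ?_⟩, hw⟩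
  refine lt_of_le_of_lt (lintegral_mono fun η => ?_)
    (lt_of_eq_of_lt (lintegral_const_mul (supLpNorm q k volume)
      ((continuous_stft u χ).measurable_supLpNorm p)) (ENNReal.mul_lt_top hkq hN))
  refine le_trans (supLpNorm_mono fun y => ?_) (supLpNorm_convolution_le hp hq hr hpqr hk
    (continuous_stft_left u χ η).enorm.measurable)
  exact (huf.enorm_stft_convolution_le hv.1 f.continuous hM hvf hw χ y η).trans_eq (hswap _)

end Convolutions

theorem mainTheorem10 (n : ℕ) (p q r : ℝ≥0∞) (hp : 1 ≤ p) (hq : 1 ≤ q) (hr : 1 ≤ r) :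
    (p⁻¹ + q⁻¹ = r⁻¹ →
      ∀ u ∈ Sw n p, ∀ v ∈ Sw n q,
        ∃ f g : Rn n →ᵇ ℂ, u.IsFun f ∧ v.IsFun g ∧
          ∃ w ∈ Sw n r, w.IsFun (fun x => f x * g x)) ∧
    (p⁻¹ + q⁻¹ = 1 + r⁻¹ →
      ∀ v : Rn n → ℂ, MemLp v q volume → ∀ u ∈ Sw n p,
        ∃ f : Rn n →ᵇ ℂ, u.IsFun f ∧
          ConvolutionExists v f (ContinuousLinearMap.mul ℂ ℂ) volume ∧
          ∃ w ∈ Sw n r, w.IsFun (v ⋆[ContinuousLinearMap.mul ℂ ℂ, volume] (f : Rn n → ℂ))) := by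
  refine ⟨fun hpqr u hu v hv => ?_, fun hpqr v hv u hu =>
    exists_convolution_mem_Sw hp hq hr hpqr hv hu⟩
  obtain ⟨χ₁, hχ₁, hN₁⟩ := mem_Sw_iff.1 hu
  obtain ⟨χ₂, hχ₂, hN₂⟩ := mem_Sw_iff.1 hv
  obtain ⟨f, huf, -⟩ := exists_boundedContinuous_of_stft u hχ₁ hp hN₁
  obtain ⟨g, hvg, -⟩ := exists_boundedContinuous_of_stft v hχ₂ hq hN₂
  obtain ⟨w, hw⟩ := Distr.exists_isFun
    ((f.continuous.mul g.continuous).locallyIntegrable (μ := volume))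
  exact ⟨f, g, huf, hvg, w, mul_mem_Sw hp hq hr hpqr huf hvg hw f.continuous hu hv, hw⟩
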